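/- Setting. Let $X$ (states) and $A$ (actions) be nonempty Borel subsets of Polish spaces. For each $x\in X$ let $A(x)\subset A$ be a nonempty measurable set of feasible actions, such that $\{(x,a): x\in X,\ a\in A(x)\}$ is measurable in $X\times A$ and contains the graph of a measurable function $X\to A$. Let $Q(\cdot\,|\,x,a)$ be a stochastic kernel on $X$ given the feasible pairs, $c$ a measurable real-valued cost on the feasible pairs, and $K\subset X$ a measurable target set. Put $\mathbb K=\{(x,a): x\in X\setminus K,\ a\in A(x)\}$ and assume: * $A(x)$ is compact for every $x\in X\setminus K$; * on $\mathbb K$ the cost $c$ is nonnegative, lower semicontinuous and inf-compact (for all $x\in X\setminus K$ and $r\in\mathbb R$ the set $\{a\in A(x): c(x,a)\le r\}$ is compact); * $Q$ is strongly Feller on $\mathbb K$: $(x,a)\mapsto\int_X g(y)\,Q(dy|x,a)$ is continuous on $\mathbb K$ for every bounded measurable $g:X\to\mathbb R$. Let $\alpha\in(0,1)$. A randomized Markov policy is a sequence $\pi=(\varphi_i)_{i\ge 0}$ of stochastic kernels on $A$ given $X$ with $\varphi_i(A(x)|x)=1$ for all $x\in X$. Let $\mathsf P^\pi_x$ (with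 expectation $\mathsf E^\pi_x$) be the law of the controlled process with $x_0=x$, $a_i\sim\varphi_i(\cdot|x_i)$, $x_{i+1}\sim Q(\cdot|x_i,a_i)$; let $\tau=\inf\{i\ge 0: x_i\in K\}$ (with $\inf\emptyset=+\infty$), and for $x\in X\setminus K$ define $$V^\star(x)=\inf_\pi \mathsf E_x^\pi\Big[\sum_{i=0}^{\tau-1}\alpha^i c(x_i,a_i)\Big]\in[0,\infty],$$ the infimum being over all randomized Markov policies. For measurable $u:X\setminus K\to[0,\infty]$ let $$Tu(x)=\inf_{a\in A(x)}\Big[c(x,a)+\alpha\int_{X\setminus K}u(y)\,Q(dy|x,a)\Big],\qquad x\in X\setminus K,$$ and let $v_0=0$, $v_n=Tv_{n-1}$ for $n\ge 1$ (the value iterations). The $\alpha$-discounted cost optimality equation ($\alpha$-DCOE) is $$\xi(x)=\min_{a\in A(x)}\Big[c(x,a)+\alpha\int_{X\setminus K}\xi(y)\,Q(dy|x,a)\Big]\qquad\text{for all }x\in X\setminus K,$$ the minimum being attained. Growth conditions. Suppose there are $\bar c>0$, $\beta\in[1,1/\alpha)$ and a measurable $w:X\setminus K\to[1,\infty)$ such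 that for all $x\in X\setminus K$ and $a\in A(x)$ $$c(x,a)\le\bar c\,w(x),\qquad \int_{X\setminus K}w(y)\,Q(dy|x,a)\le\beta\,w(x).$$ Put $\gamma=\alpha\beta$, $\|u\|_w=\sup_{x\in X\setminus K}|u(x)|/w(x)$, and let $L_w^+$ be the set of measurable $u:X\setminus K\to[0,\infty]$ with $\|u\|_w<\infty$. **Proposition.** Under these assumptions: (i) $\|V^\star\|_w\le\bar c/(1-\gamma)$. (ii) The functions $v_n$ are measurable, the infima defining them are attained, and $$V^\star(x)-v_n(x)\le\bar c\,w(x)\,\frac{\gamma^n}{1-\gamma}\qquad\text{for all }x\in X\setminus K,\ n\ge 0;$$ moreover $\|v_n-V^\star\|_w\le\bar c\,\gamma^n/(1-\gamma)$ for all $n\ge 0$. (iii) $V^\star$ belongs to $L_w^+$, solves the $\alpha$-DCOE, and is the only element of $L_w^+$ that solves it. Moreover $0\le\gamma<1$, and $T$ maps $L_w^+$ into itself and is a $\gamma$-contraction there: $\|Tu-Tu'\|_w\le\gamma\|u-u'\|_w$ for all $u,u'\in L_w^+$. -/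

import Mathlib

open MeasureTheory ProbabilityTheory
open scoped ENNReal

noncomputable section

namespace ExitControl

/-- A Markov control model `(X, A, {A(x)}, Q, c)`: `feasible x` is `A(x)`, and the transition law
`Q` and the cost-per-stage `c` live on the set of feasible state-action pairs. -/
structure MarkovControlModel (X A : Type*) [MeasurableSpace X] [MeasurableSpace A] where
  /-- the set `A(x)` of feasible actions -/
  feasible : X → Set A
  feasible_nonempty : ∀ x, (feasible x).Nonempty
  measurableSet_feasible : ∀ x, MeasurableSet (feasible x)
  measurableSet_pairs : MeasurableSet {p : X × A | p.2 ∈ feasible p.1}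
  /-- the transition law: a stochastic kernel on `X` given the feasible pairs -/
  Q : Kernel {p : X × A | p.2 ∈ feasible p.1} X
  isMarkovKernel_Q : IsMarkovKernel Q
  /-- the cost-per-stage function -/
  c : {p : X × A | p.2 ∈ feasible p.1} → ℝ
  measurable_c : Measurable c

namespace MarkovControlModel

variable {X A : Type*} [MeasurableSpace X] [MeasurableSpace A] (M : MarkovControlModel X A)

/-- The set of feasible state-action pairs. -/
def pairs : Set (X × A) := {p | p.2 ∈ M.feasible p.1}

/-- The feasible pairs whose state lies outside `K`, as a subset of the feasible pairs. -/
def pairsOff (K : Set X) : Set M.pairs := {p | p.1.1 ∉ K}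

/-- The feasible pairs contain the graph of a measurable function from `X` to `A`. -/
def HasMeasurableSelector : Prop :=
  ∃ f : X → A, Measurable f ∧ ∀ x, f x ∈ M.feasible x

/-- The cost-per-stage is inf-compact on the feasible pairs with state outside `K`. -/
def CostInfCompact [TopologicalSpace A] (K : Set X) : Prop :=
  ∀ x, x ∉ K → ∀ r : ℝ, IsCompact {a : A | ∃ h : a ∈ M.feasible x, M.c ⟨(x, a), h⟩ ≤ r}

/-- `Q` is strongly Feller on the feasible pairs with state outside `K`: integration against `Q`
turns bounded measurable functions into continuous ones (boundedness is automatic, as every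
`Q(·|x,a)` is a probability measure). -/
def StronglyFeller [TopologicalSpace X] [TopologicalSpace A] (K : Set X) : Prop :=
  ∀ g : X → ℝ, Measurable g → (∃ C : ℝ, ∀ y, |g y| ≤ C) →
    ContinuousOn (fun p : M.pairs => ∫ y, g y ∂(M.Q p)) (M.pairsOff K)

/-- A randomized Markov policy `(φ₀, φ₁, …)`: stochastic kernels on `A` given `X` with
`φ_i(A(x) | x) = 1`. -/
structure Policy where
  φ : ℕ → Kernel X A
  isMarkovKernel_φ : ∀ i, IsMarkovKernel (φ i)
  φ_feasible : ∀ i x, φ i x (M.feasible x) = 1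

open Classical in
/-- The transition law extended to all of `X × A`, by `δ_x` off the feasible pairs. The law of the
controlled process does not charge infeasible pairs, so this extension plays no role. -/
def Qext : Kernel (X × A) X where
  toFun p := if h : p ∈ M.pairs then M.Q ⟨p, h⟩ else Measure.dirac p.1
  measurable' :=
    Measurable.dite (s := M.pairs) (f := fun p => M.Q p) (g := fun p => Measure.dirac p.1.1)
      M.Q.measurable
      (Measure.measurable_dirac.comp (measurable_fst.comp measurable_subtype_coe))
      M.measurableSet_pairs

lemma Qext_of_mem {p : X × A} (h : p ∈ M.pairs) : M.Qext p = M.Q ⟨p, h⟩ :=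
  dif_pos h

lemma Qext_of_notMem {p : X × A} (h : p ∉ M.pairs) : M.Qext p = Measure.dirac p.1 :=
  dif_neg h

instance : IsMarkovKernel M.Qext where
  isProbabilityMeasure p := by
    have := M.isMarkovKernel_Q
    by_cases h : p ∈ M.pairs
    · rw [M.Qext_of_mem h]; infer_instance
    · rw [M.Qext_of_notMem h]; infer_instance

open Classical in
/-- The cost-per-stage extended to all of `X × A` by `0` off the feasible pairs (which are not
charged by the law of the controlled process). -/
def cext (p : X × A) : ℝ := if h : p ∈ M.pairs then M.c ⟨p, h⟩ else 0

variable {M}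

/-- The conditional law of `(x_{n+1}, a_{n+1})` given the history up to time `n`:
`x_{n+1} ∼ Q(· | x_n, a_n)` and then `a_{n+1} ∼ φ_{n+1}(· | x_{n+1})`. -/
def Policy.step (π : M.Policy) (n : ℕ) : Kernel (Finset.Iic n → X × A) (X × A) :=
  (M.Qext ⊗ₖ Kernel.prodMkLeft (X × A) (π.φ (n + 1))).comap
    (fun h => h ⟨n, Finset.mem_Iic.2 le_rfl⟩) (measurable_pi_apply _)

instance (π : M.Policy) (n : ℕ) : IsMarkovKernel (π.step n) := by
  have := π.isMarkovKernel_φ (n + 1)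
  unfold Policy.step
  infer_instance

/-- The Ionescu-Tulcea law `P_x^π` of the controlled process on the canonical space `(X × A)^∞`,
started from `x_0 = x`, `a_0 ∼ φ_0(· | x)`. -/
def Policy.law (π : M.Policy) (x : X) : Measure (ℕ → X × A) :=
  Kernel.trajMeasure (X := fun _ => X × A) ((Measure.dirac x) ⊗ₘ (π.φ 0)) π.step

/-- `τ = inf {i | x_i ∈ K}`, equal to `⊤` if `K` is never reached. -/
def hitTime (K : Set X) (ω : ℕ → X × A) : ℕ∞ :=
  ⨅ (i : ℕ) (_ : (ω i).1 ∈ K), (i : ℕ∞)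

open Classical in
/-- `V(π, x) = E_x^π [∑_{i=0}^{τ-1} α^i c(x_i, a_i)]` (for a cost that is nonnegative outside
`K`), with values in `[0, ∞]`. -/
def Policy.cost (π : M.Policy) (K : Set X) (α : ℝ) (x : X) : ℝ≥0∞ :=
  ∫⁻ ω, ∑' i : ℕ, (if (i : ℕ∞) < hitTime K ω then ENNReal.ofReal (α ^ i * M.cext (ω i)) else 0)
    ∂(π.law x)

variable (M)

/-- The `α`-discount value function `V⋆(x) = inf_π V(π, x)`, on `X ∖ K`. -/
def value (K : Set X) (α : ℝ) (x : (Kᶜ : Set X)) : ℝ≥0∞ :=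
  ⨅ π : M.Policy, π.cost K α x

/-- `c(x, a) + α ∫_{X ∖ K} Q(dy | x, a) u(y)` for a feasible pair `p = (x, a)`. -/
def stageCost (K : Set X) (α : ℝ) (u : (Kᶜ : Set X) → ℝ≥0∞) (p : M.pairs) : ℝ≥0∞ :=
  ENNReal.ofReal (M.c p)
    + ENNReal.ofReal α * ∫⁻ y, u y ∂((M.Q p).comap (Subtype.val : (Kᶜ : Set X) → X))

/-- The dynamic programming operator
`T u (x) = inf_{a ∈ A(x)} [c(x, a) + α ∫_{X ∖ K} Q(dy | x, a) u(y)]`. -/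
def T (K : Set X) (α : ℝ) (u : (Kᶜ : Set X) → ℝ≥0∞) (x : (Kᶜ : Set X)) : ℝ≥0∞ :=
  ⨅ a : M.feasible x, M.stageCost K α u ⟨((x : X), (a : A)), a.2⟩

/-- `t` is the minimum (attained) over `a ∈ A(x)` of
`c(x, a) + α ∫_{X ∖ K} Q(dy | x, a) u(y)`. -/
def IsMinStage (K : Set X) (α : ℝ) (u : (Kᶜ : Set X) → ℝ≥0∞) (x : (Kᶜ : Set X)) (t : ℝ≥0∞) :
    Prop :=
  IsLeast (Set.range fun a : M.feasible x => M.stageCost K α u ⟨((x : X), (a : A)), a.2⟩) t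

/-- `u` solves the `α`-discounted cost optimality equation, with an attained minimum. -/
def SolvesDCOE (K : Set X) (α : ℝ) (u : (Kᶜ : Set X) → ℝ≥0∞) : Prop :=
  ∀ x, M.IsMinStage K α u x (u x)

/-- The value iteration functions `v_0 = 0`, `v_n = T v_{n-1}`. -/
def valueIter (K : Set X) (α : ℝ) : ℕ → (Kᶜ : Set X) → ℝ≥0∞
  | 0 => fun _ => 0
  | n + 1 => M.T K α (valueIter K α n)

end MarkovControlModel

/-- The weighted norm `‖u‖_w = sup |u| / w` of an extended-real-valued function. -/
def wnorm {S : Type*} (w : S → ℝ) (u : S → EReal) : ℝ≥0∞ :=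
  ⨆ x, (u x).abs / ENNReal.ofReal (w x)

/-- `u` is a measurable `[0,∞]`-valued function with finite weighted norm. -/
def InWeightedCone {S : Type*} [MeasurableSpace S] (w : S → ℝ) (u : S → ℝ≥0∞) : Prop :=
  Measurable u ∧ wnorm w (fun x => (u x : EReal)) < ⊤

end ExitControl

end

/-! Two facts identify the value function with the limit of the value iterations `v_n`. Unrolling
`v_n = T v_{n-1}` along the process of any policy gives `v_n ≤ V(π, ·)`
(`Policy.valueIter_le_cost`), because the iteration stops with `v_0 = 0` and so drops the costs from
time `n` on. In the other direction, a measurable `f` minimizing the stage cost for `u = sup_n v_n`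
defines a stationary policy of cost at most `u`, as soon as `T u ≤ u` (`Policy.cost_stationary_le`).

That `u` is a fixed point follows from the growth conditions. They make `T` a `γ`-contraction for
`w` (`WeightedGrowth.T_le_T_add`), so `v_{n+1} - v_n ≤ cbar γ^n w`. Summing the geometric series
bounds `u - v_n`, and applying `T` to this bound exchanges `T` with the limit
(`WeightedGrowth.T_iSup_valueIter`). The same series gives the stated error bounds, and the
contraction gives uniqueness.

The delicate point is measurability. Nothing is assumed about the continuity of `x ↦ A(x)`, so `T u`
need not be semicontinuous. For fixed `x`, however, the stage cost is lower semicontinuous on the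
compact set `A(x)`, by the strong Feller property. Sublevel sets are therefore Borel with compact
sections. Such sets have Borel projections (`measurableSet_image_fst_of_isCompact_sections`) and,
when all sections are nonempty, measurable selectors
(`exists_measurable_selector_of_isCompact_sections`). Both rest on Novikov's separation theorem. -/

noncomputable section

namespace ExitControl

/-! ### Novikov's separation theorem for sequences of analytic sets. -/

section Novikov

variable {α : Type*}

/-- A sequence of sets is jointly Borel separated if its members can be enlarged to measurable sets
with empty intersection. -/
def JointlySeparated [MeasurableSpace α] (s : ℕ → Set α) : Prop :=
  ∃ B : ℕ → Set α, (∀ n, MeasurableSet (B n)) ∧ (∀ n, s n ⊆ B n) ∧ ⋂ n, B n = ∅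

/-- Take the union of the enlargements at index `m` and their intersection elsewhere: a common point
lies in the `m`-th enlargement of some piece `i`, hence in all enlargements of that piece. So if a
sequence is not separated, cutting one member into countably many pieces leaves a sequence that is
not separated. -/
lemma JointlySeparated.of_iUnion [MeasurableSpace α] {s : ℕ → Set α} {t : ℕ → ℕ → Set α} (m : ℕ)
    (hm : s m ⊆ ⋃ i, t i m) (hne : ∀ n, n ≠ m → ∀ i, s n ⊆ t i n)
    (ht : ∀ i, JointlySeparated (t i)) : JointlySeparated s := by
  classical
  choose B hB hsub hint using ht
  refine ⟨fun n => if n = m then ⋃ i, B i n else ⋂ i, B i n, fun n => ?_, fun n => ?_, ?_⟩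
  · by_cases h : n = m
    · simpa [h] using MeasurableSet.iUnion fun i => hB i m
    · simpa [h] using MeasurableSet.iInter fun i => hB i n
  · by_cases h : n = m
    · subst h
      simpa using hm.trans (Set.iUnion_mono fun i => hsub i n)
    · simpa [h] using fun i => (hne n h i).trans (hsub i n)
  · refine Set.eq_empty_of_forall_notMem fun x hx => ?_
    rw [Set.mem_iInter] at hx
    have h0 := hx m
    simp only [if_true, Set.mem_iUnion] at h0
    obtain ⟨i, hi⟩ := h0
    have : x ∈ ⋂ n, B i n := by
      refine Set.mem_iInter.2 fun n => ?_
      by_cases h : n = m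
      · exact h ▸ hi
      · have := hx n
        simp only [h, if_false, Set.mem_iInter] at this
        exact this i
    rw [hint i] at this
    exact this

/-- The image under `f n` of the points whose coordinates `j` with `Nat.pair n j < k` agree with
those coded by `z`. -/
def codedImage (f : ℕ → (ℕ → ℕ) → α) (z : ℕ → ℕ) (k n : ℕ) : Set α :=
  f n '' {y | ∀ j, Nat.pair n j < k → y j = z (Nat.pair n j)}

lemma codedImage_congr {f : ℕ → (ℕ → ℕ) → α} {z z' : ℕ → ℕ} {k : ℕ} (h : ∀ i < k, z i = z' i) :
    codedImage f z k = codedImage f z' k := by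
  funext n
  unfold codedImage
  congr 1
  ext y
  exact forall₂_congr fun j hj => by rw [h _ hj]

/-- With `k = Nat.pair n j`, prescribing `z k` fixes coordinate `j` of the `n`-th parameter. This
cuts only the `n`-th image, into countably many pieces. -/
lemma exists_not_jointlySeparated_update [MeasurableSpace α] {f : ℕ → (ℕ → ℕ) → α} {z : ℕ → ℕ}
    {k : ℕ} (h : ¬JointlySeparated (codedImage f z k)) :
    ∃ i, ¬JointlySeparated (codedImage f (Function.update z k i) (k + 1)) := by
  contrapose! h
  refine JointlySeparated.of_iUnion (Nat.unpair k).1 ?_ (fun n hn i => ?_) h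
  · rintro _ ⟨y, hy, rfl⟩
    refine Set.mem_iUnion.2 ⟨y (Nat.unpair k).2, y, fun j hj => ?_, rfl⟩
    by_cases hjk : Nat.pair (Nat.unpair k).1 j = k
    · have hj' : j = (Nat.unpair k).2 := by rw [← hjk]; simp
      rw [hjk, Function.update_self, hj']
    · rw [Function.update_of_ne hjk]
      exact hy j (by omega)
  · rintro _ ⟨y, hy, rfl⟩
    refine ⟨y, fun j hj => ?_, rfl⟩
    have hjk : Nat.pair n j ≠ k := by
      rintro rfl
      simp at hn
    rw [Function.update_of_ne hjk]
    exact hy j (by omega)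

/-- Otherwise all parameters can be fixed one coordinate at a time without ever reaching a separated
sequence. The limiting parameters have two distinct image points, since the ranges have no common
point. Disjoint neighbourhoods of these two points separate the sequence at a late enough stage. -/
lemma jointlySeparated_range [TopologicalSpace α] [T2Space α] [MeasurableSpace α]
    [OpensMeasurableSpace α] {f : ℕ → (ℕ → ℕ) → α} (hf : ∀ n, Continuous (f n))
    (h : ⋂ n, Set.range (f n) = ∅) : JointlySeparated fun n => Set.range (f n) := by
  by_contra hsep
  have step : ∀ k z, ∃ i, ¬JointlySeparated (codedImage f z k) →
      ¬JointlySeparated (codedImage f (Function.update z k i) (k + 1)) := by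
    intro k z
    by_cases hz : JointlySeparated (codedImage f z k)
    -- Arbitrary value: the implication is vacuous here.
    · exact ⟨0, fun h' => absurd hz h'⟩
    · obtain ⟨i, hi⟩ := exists_not_jointlySeparated_update hz
      exact ⟨i, fun _ => hi⟩
  choose F hF using step
  let Z : ℕ → ℕ → ℕ := fun k => Nat.rec (fun _ => 0) (fun k z => Function.update z k (F k z)) k
  have Zsucc : ∀ k, Z (k + 1) = Function.update (Z k) k (F k (Z k)) := fun _ => rfl
  have hZ : ∀ k, ¬JointlySeparated (codedImage f (Z k) k) := by
    intro k
    induction k with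
    | zero =>
      have : codedImage f (Z 0) 0 = fun n => Set.range (f n) := by
        funext n; simp [codedImage]
      rwa [this]
    | succ k ih => exact hF k _ ih
  -- Coordinate `i` is set at stage `i + 1` and never changed afterwards, so the stages have a
  -- diagonal limit.
  have hstab : ∀ i k, i < k → Z k i = Z (i + 1) i := by
    intro i k hk
    induction k, hk using Nat.le_induction with
    | base => rfl
    | succ k hk ih => rw [Zsucc, Function.update_of_ne (by omega), ih]
  set z : ℕ → ℕ := fun i => Z (i + 1) i with hz
  have hzsep : ∀ k, ¬JointlySeparated (codedImage f z k) := by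
    intro k
    rw [codedImage_congr (z' := Z k) fun i hi => (hstab i k hi).symm]
    exact hZ k
  let y : ℕ → ℕ → ℕ := fun n j => z (Nat.pair n j)
  obtain ⟨a, b, hab⟩ : ∃ a b, f a (y a) ≠ f b (y b) := by
    by_contra! hcon
    have : f 0 (y 0) ∈ ⋂ n, Set.range (f n) := Set.mem_iInter.2 fun n => ⟨y n, hcon n 0⟩
    rw [h] at this
    exact this
  obtain ⟨u, v, hu, hv, hau, hbv, huv⟩ := t2_separation hab
  have key : ∀ (n : ℕ) (u : Set α), IsOpen u → f n (y n) ∈ u → ∃ k₀, ∀ k ≥ k₀,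
      codedImage f z k n ⊆ u := by
    intro n u hu hmem
    obtain ⟨_, ⟨x, m, rfl⟩, hyx, hsub⟩ :=
      (PiNat.isTopologicalBasis_cylinders (fun _ : ℕ => ℕ)).exists_subset_of_mem_open
        (show y n ∈ f n ⁻¹' u from hmem) (hu.preimage (hf n))
    -- Since `Nat.pair n i < Nat.pair n m` for `i < m`, from this stage on the first `m` coordinates
    -- are fixed and the parameters stay in the cylinder.
    refine ⟨Nat.pair n m, fun k hk => ?_⟩
    rintro _ ⟨y', hy', rfl⟩
    refine hsub (PiNat.mem_cylinder_iff.2 fun i hi => ?_)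
    rw [hy' i ((Nat.pair_lt_pair_right n hi).trans_le hk), ← PiNat.mem_cylinder_iff.1 hyx i hi]
  obtain ⟨k₁, h₁⟩ := key a u hu hau
  obtain ⟨k₂, h₂⟩ := key b v hv hbv
  have hne : a ≠ b := by rintro rfl; exact hab rfl
  classical
  refine hzsep (max k₁ k₂) ⟨fun n => if n = a then u else if n = b then v else Set.univ,
    fun n => ?_, fun n => ?_, ?_⟩
  · dsimp only
    split_ifs
    exacts [hu.measurableSet, hv.measurableSet, MeasurableSet.univ]
  · dsimp only
    split_ifs with h1 h2
    · subst h1; exact h₁ _ (le_max_left _ _)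
    · subst h2; exact h₂ _ (le_max_right _ _)
    · exact Set.subset_univ _
  · refine Set.eq_empty_of_forall_notMem fun x hx => ?_
    rw [Set.mem_iInter] at hx
    have hxa := hx a
    have hxb := hx b
    simp only [if_true, hne.symm, if_false] at hxa hxb
    exact Set.disjoint_left.1 huv hxa hxb

/-- **Novikov's separation theorem**: a sequence of analytic sets with empty intersection can be
enlarged to measurable sets with empty intersection. -/
theorem jointlySeparated_of_analyticSet [TopologicalSpace α] [T2Space α] [MeasurableSpace α]
    [OpensMeasurableSpace α] {s : ℕ → Set α} (hs : ∀ n, AnalyticSet (s n))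
    (h : ⋂ n, s n = ∅) : JointlySeparated s := by
  classical
  -- An analytic set is empty or a continuous image of Baire space; only in the second case is there
  -- a parametrization.
  by_cases hne : ∃ n, s n = ∅
  · obtain ⟨m, hm⟩ := hne
    refine ⟨fun n => if n = m then ∅ else Set.univ, fun n => ?_, fun n => ?_, ?_⟩
    · dsimp only
      split_ifs <;> simp
    · by_cases h : n = m
      · simp [h, hm]
      · simp [h]
    · exact Set.subset_empty_iff.1 ((Set.iInter_subset _ m).trans (by simp))
  · push Not at hne
    have : ∀ n, ∃ f : (ℕ → ℕ) → α, Continuous f ∧ Set.range f = s n := by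
      intro n
      have := hs n
      rw [AnalyticSet] at this
      exact this.resolve_left (hne n).ne_empty
    choose f hf hfs using this
    have hfun : s = fun n => Set.range (f n) := funext fun n => (hfs n).symm
    rw [hfun] at h ⊢
    exact jointlySeparated_range hf h

end Novikov

/-! ### Borel projections and measurable selectors for sets with compact sections. -/

section Projection

/-- A Borel set with open sections is a countable union of measurable rectangles whose second
factors are taken from a given countable basis. -/
theorem exists_eq_iUnion_prod_of_isOpen_sections {X Y : Type*}
    [TopologicalSpace X] [PolishSpace X] [MeasurableSpace X] [BorelSpace X]
    [TopologicalSpace Y] [PolishSpace Y] [MeasurableSpace Y] [BorelSpace Y]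
    {U : Set (X × Y)} (hU : MeasurableSet U) (hopen : ∀ x, IsOpen {y | (x, y) ∈ U})
    {V : ℕ → Set Y} (hV : TopologicalSpace.IsTopologicalBasis (Set.range V)) :
    ∃ B : ℕ → Set X, (∀ n, MeasurableSet (B n)) ∧ U = ⋃ n, B n ×ˢ V n := by
  have hVo : ∀ n, IsOpen (V n) := fun n => hV.isOpen ⟨n, rfl⟩
  -- the complements of the sets `{x | V n ⊆ U_x}` are analytic
  set P : ℕ → Set X := fun n => Prod.fst '' (Uᶜ ∩ Set.univ ×ˢ V n) with hP
  have hPan : ∀ n, AnalyticSet (P n) := fun n =>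
    ((hU.compl.inter (MeasurableSet.univ.prod (hVo n).measurableSet)).analyticSet).image_of_continuous
      continuous_fst
  have hPmem : ∀ n x, x ∉ P n → ∀ y ∈ V n, (x, y) ∈ U := by
    intro n x hx y hy
    by_contra hxy
    exact hx ⟨(x, y), ⟨hxy, trivial, hy⟩, rfl⟩
  -- The `n`-th set is the part of `U` outside the rectangle `(P n)ᶜ ×ˢ V n`. These rectangles cover
  -- `U`, but their first factors are only coanalytic; Novikov's theorem serves to shrink them to
  -- Borel sets.
  have hsan : ∀ n, AnalyticSet (U ∩ (P n ×ˢ Set.univ ∪ Set.univ ×ˢ (V n)ᶜ)) := by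
    intro n
    have h1 : AnalyticSet (P n ×ˢ (Set.univ : Set Y)) := by
      have := (hPan n).preimage (continuous_fst : Continuous (Prod.fst : X × Y → X))
      rwa [← Set.prod_univ] at this
    have h2 : AnalyticSet ((Set.univ : Set X) ×ˢ (V n)ᶜ) :=
      (MeasurableSet.univ.prod (hVo n).measurableSet.compl).analyticSet
    have h3 : AnalyticSet (P n ×ˢ (Set.univ : Set Y) ∪ (Set.univ : Set X) ×ˢ (V n)ᶜ) := by
      rw [Set.union_eq_iUnion]
      exact AnalyticSet.iUnion fun b => by cases b <;> assumption
    rw [Set.inter_eq_iInter]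
    exact AnalyticSet.iInter fun b => by
      cases b
      · exact h3
      · exact hU.analyticSet
  have hempty : ⋂ n, (U ∩ (P n ×ˢ Set.univ ∪ Set.univ ×ˢ (V n)ᶜ)) = ∅ := by
    refine Set.eq_empty_of_forall_notMem ?_
    rintro ⟨x, y⟩ hxy
    rw [Set.mem_iInter] at hxy
    obtain ⟨_, ⟨n, rfl⟩, hyn, hsub⟩ := hV.exists_subset_of_mem_open
      (show y ∈ {y | (x, y) ∈ U} from (hxy 0).1) (hopen x)
    rcases (hxy n).2 with h | h
    · obtain ⟨⟨x', y'⟩, ⟨hU', _, hy'⟩, rfl⟩ := h.1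
      exact hU' (hsub hy')
    · exact h.2 hyn
  obtain ⟨B, hB, hsB, hBe⟩ := jointlySeparated_of_analyticSet hsan hempty
  have hUB : ∀ n, ∀ p ∈ U \ B n, p.1 ∉ P n ∧ p.2 ∈ V n := by
    rintro n p ⟨hpU, hpB⟩
    refine ⟨fun h => hpB (hsB n ⟨hpU, Or.inl ⟨h, trivial⟩⟩), ?_⟩
    by_contra h
    exact hpB (hsB n ⟨hpU, Or.inr ⟨trivial, h⟩⟩)
  -- Off `B n` the set `U` lies in `(P n)ᶜ ×ˢ V n`, so Lusin separation of two disjoint analytic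
  -- sets gives a Borel first factor.
  have hsepn : ∀ n, MeasurablySeparable (Prod.fst '' (U \ B n)) (P n) := fun n =>
    ((hU.diff (hB n)).analyticSet.image_of_continuous continuous_fst).measurablySeparable (hPan n)
      (Set.disjoint_left.2 (by rintro _ ⟨p, hp, rfl⟩ h; exact (hUB n p hp).1 h))
  choose C hsC hCP hC using hsepn
  refine ⟨C, hC, Set.Subset.antisymm ?_ ?_⟩
  · intro p hp
    have : p ∉ ⋂ n, B n := by rw [hBe]; exact Set.notMem_empty p
    rw [Set.mem_iInter] at this
    push Not at this
    obtain ⟨n, hn⟩ := this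
    exact Set.mem_iUnion.2 ⟨n, hsC n ⟨p, ⟨hp, hn⟩, rfl⟩, (hUB n p ⟨hp, hn⟩).2⟩
  · rintro ⟨x, y⟩ hp
    obtain ⟨n, hx, hy⟩ := Set.mem_iUnion.1 hp
    exact hPmem n x (fun h => Set.disjoint_left.1 (hCP n) h hx) y hy

/-- A Borel subset of a product with closed sections in a compact second factor has a Borel
projection. -/
theorem measurableSet_image_fst_of_isClosed_sections {X Y : Type*}
    [MeasurableSpace X] [StandardBorelSpace X]
    [TopologicalSpace Y] [PolishSpace Y] [CompactSpace Y] [MeasurableSpace Y] [BorelSpace Y]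
    {G : Set (X × Y)} (hG : MeasurableSet G) (hclosed : ∀ x, IsClosed {y | (x, y) ∈ G}) :
    MeasurableSet (Prod.fst '' G) := by
  let := upgradeStandardBorel X
  obtain ⟨V, hV⟩ : ∃ V : ℕ → Set Y, TopologicalSpace.IsTopologicalBasis (Set.range V) := by
    -- Adding `∅` makes the countable basis nonempty, so that it can be enumerated by `ℕ`.
    obtain ⟨V, hV⟩ := ((TopologicalSpace.countable_countableBasis Y).insert ∅).exists_eq_range
      (Set.insert_nonempty _ _)
    exact ⟨V, hV ▸ (TopologicalSpace.isBasis_countableBasis Y).insert_empty⟩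
  obtain ⟨B, hB, hGB⟩ := exists_eq_iUnion_prod_of_isOpen_sections hG.compl
    (fun x => (hclosed x).isOpen_compl) hV
  have hmem : ∀ x y, (x, y) ∉ G ↔ ∃ n, x ∈ B n ∧ y ∈ V n := by
    intro x y
    rw [← Set.mem_compl_iff, hGB]
    simp
  -- A point `x` misses the projection iff the `V n` with `x ∈ B n` cover `Y`. By compactness
  -- finitely many suffice, and there are only countably many finite index sets.
  have hcompl : (Prod.fst '' G)ᶜ =
      ⋃ (t : Finset ℕ) (_ : ⋃ n ∈ t, V n = Set.univ), ⋂ n ∈ t, B n := by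
    ext x
    simp only [Set.mem_compl_iff, Set.mem_iUnion, Set.mem_iInter, exists_prop]
    constructor
    · intro hx
      have hcov : (Set.univ : Set Y) ⊆ ⋃ n : {n // x ∈ B n}, V n := by
        intro y _
        have : (x, y) ∉ G := fun h => hx ⟨_, h, rfl⟩
        obtain ⟨n, hn, hy⟩ := (hmem x y).1 this
        exact Set.mem_iUnion.2 ⟨⟨n, hn⟩, hy⟩
      obtain ⟨t, ht⟩ := isCompact_univ.elim_finite_subcover _ (fun n => hV.isOpen ⟨_, rfl⟩) hcov
      classical
      refine ⟨t.image Subtype.val, ?_, ?_⟩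
      · rw [Finset.set_biUnion_finset_image]
        exact Set.univ_subset_iff.1 ht
      · intro n hn
        obtain ⟨m, _, rfl⟩ := Finset.mem_image.1 hn
        exact m.2
    · rintro ⟨t, ht, hx⟩ ⟨⟨x', y⟩, hG', rfl⟩
      have : y ∈ ⋃ n ∈ t, V n := ht ▸ trivial
      simp only [Set.mem_iUnion] at this
      obtain ⟨n, hn, hy⟩ := this
      exact (hmem x' y).2 ⟨n, hx n hn, hy⟩ hG'
  rw [← MeasurableSet.compl_iff, hcompl]
  exact MeasurableSet.iUnion fun t => MeasurableSet.iUnion fun _ =>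
    MeasurableSet.biInter t.countable_toSet fun n _ => hB n

lemma exists_continuous_injective_hilbertCube (Y : Type*) [TopologicalSpace Y]
    [TopologicalSpace.MetrizableSpace Y] [SecondCountableTopology Y] :
    ∃ F : Y → ℕ → unitInterval, Continuous F ∧ Function.Injective F := by
  let := TopologicalSpace.metrizableSpaceMetric Y
  obtain ⟨F, hF⟩ := Metric.PiNatEmbed.exists_embedding_to_hilbert_cube (X := Y)
  exact ⟨F, hF.continuous, hF.injective⟩

/-- The set of points of `G` that minimise `f` over their section. -/
def sectionMinimizers {X Y : Type*} (f : Y → ℝ) (G : Set (X × Y)) : Set (X × Y) :=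
  {p | p ∈ G ∧ ∀ b, (p.1, b) ∈ G → f p.2 ≤ f b}

lemma isCompact_sectionMinimizers {X Y : Type*} [TopologicalSpace Y]
    {f : Y → ℝ} (hf : Continuous f) {G : Set (X × Y)} {x : X}
    (hcompact : IsCompact {y | (x, y) ∈ G}) : IsCompact {y | (x, y) ∈ sectionMinimizers f G} := by
  have : {y | (x, y) ∈ sectionMinimizers f G} =
      {y | (x, y) ∈ G} ∩ ⋂ (b : Y) (_ : (x, b) ∈ G), {y | f y ≤ f b} := by
    ext y
    simp [sectionMinimizers]
  rw [this]
  exact hcompact.inter_right (isClosed_biInter fun b _ => isClosed_le hf continuous_const)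

lemma nonempty_sectionMinimizers {X Y : Type*} [TopologicalSpace Y]
    {f : Y → ℝ} (hf : Continuous f) {G : Set (X × Y)} {x : X}
    (hcompact : IsCompact {y | (x, y) ∈ G}) (hne : {y | (x, y) ∈ G}.Nonempty) :
    {y | (x, y) ∈ sectionMinimizers f G}.Nonempty := by
  obtain ⟨y, hy, hmin⟩ := hcompact.exists_isMinOn hne hf.continuousOn
  exact ⟨y, hy, fun b hb => hmin hb⟩

variable {X Y : Type*} [MeasurableSpace X] [StandardBorelSpace X]
  [TopologicalSpace Y] [TopologicalSpace.MetrizableSpace Y] [SecondCountableTopology Y]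
  [MeasurableSpace Y] [BorelSpace Y] [StandardBorelSpace Y]

/-- A Borel set with compact sections has a Borel projection. -/
theorem measurableSet_image_fst_of_isCompact_sections
    {G : Set (X × Y)} (hG : MeasurableSet G) (hcompact : ∀ x, IsCompact {y | (x, y) ∈ G}) :
    MeasurableSet (Prod.fst '' G) := by
  obtain ⟨F, hF, hFi⟩ := exists_continuous_injective_hilbertCube Y
  have hm : Measurable (Prod.map id F : X × Y → X × (ℕ → unitInterval)) :=
    measurable_id.prodMap hF.measurable
  -- Injective Borel images of Borel sets are Borel (Lusin–Souslin), so the problem moves to the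
  -- compact Hilbert cube, where compact sections are closed.
  have hG' : MeasurableSet (Prod.map id F '' G) :=
    hG.image_of_measurable_injOn hm (Function.Injective.prodMap Function.injective_id hFi).injOn
  have hsec : ∀ x, {z | (x, z) ∈ Prod.map id F '' G} = F '' {y | (x, y) ∈ G} := by
    intro x
    ext z
    constructor
    · rintro ⟨⟨x', y⟩, h, he⟩
      obtain ⟨rfl, rfl⟩ := Prod.ext_iff.1 he
      exact ⟨y, h, rfl⟩
    · rintro ⟨y, h, rfl⟩
      exact ⟨(x, y), h, rfl⟩
  have := measurableSet_image_fst_of_isClosed_sections hG' fun x => by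
    rw [hsec]
    exact ((hcompact x).image hF).isClosed
  rwa [Set.image_image, show (fun p : X × Y => (Prod.map id F p).1) = Prod.fst from rfl] at this

/-- A point of `G` fails to be a minimizer exactly when some rational lies strictly below its value
and at or above another value on the section. The latter condition defines a Borel projection. -/
lemma measurableSet_sectionMinimizers {f : Y → ℝ} (hf : Continuous f) {G : Set (X × Y)}
    (hG : MeasurableSet G) (hcompact : ∀ x, IsCompact {y | (x, y) ∈ G}) :
    MeasurableSet (sectionMinimizers f G) := by
  have hlev : ∀ r : ℝ, MeasurableSet (Prod.fst '' (G ∩ {p | f p.2 ≤ r})) := by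
    intro r
    refine measurableSet_image_fst_of_isCompact_sections
      (hG.inter (measurableSet_le (hf.measurable.comp measurable_snd) measurable_const)) fun x => ?_
    exact (hcompact x).inter_right (isClosed_le hf continuous_const)
  have heq : sectionMinimizers f G =
      G \ ⋃ q : ℚ, {p | (q : ℝ) < f p.2} ∩ Prod.fst ⁻¹' (Prod.fst '' (G ∩ {p | f p.2 ≤ q})) := by
    ext ⟨x, y⟩
    constructor
    · rintro ⟨h, hmin⟩
      refine ⟨h, fun hmem => ?_⟩
      obtain ⟨q, hq, ⟨x', b⟩, ⟨hb, hbq⟩, rfl⟩ := Set.mem_iUnion.1 hmem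
      exact absurd (hmin b hb) (not_le.2 (lt_of_le_of_lt hbq hq))
    · rintro ⟨h, hn⟩
      refine ⟨h, fun b hb => ?_⟩
      by_contra! hlt
      obtain ⟨q, h1, h2⟩ := exists_rat_btwn hlt
      exact hn (Set.mem_iUnion.2 ⟨q, h2, ⟨(x, b), ⟨hb, h1.le⟩, rfl⟩⟩)
  rw [heq]
  refine hG.diff (MeasurableSet.iUnion fun q => MeasurableSet.inter ?_ (measurable_fst (hlev q)))
  exact measurableSet_lt measurable_const (hf.measurable.comp measurable_snd)

/-- A Borel set with nonempty compact sections admits a measurable selector. -/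
theorem exists_measurable_selector_of_isCompact_sections
    {G : Set (X × Y)} (hG : MeasurableSet G) (hcompact : ∀ x, IsCompact {y | (x, y) ∈ G})
    (hne : ∀ x, {y | (x, y) ∈ G}.Nonempty) :
    ∃ s : X → Y, Measurable s ∧ ∀ x, (x, s x) ∈ G := by
  obtain ⟨F, hF, hFi⟩ := exists_continuous_injective_hilbertCube Y
  let f : ℕ → Y → ℝ := fun n y => F y n
  have hf : ∀ n, Continuous (f n) := fun n =>
    continuous_subtype_val.comp ((continuous_apply n).comp hF)
  -- Minimize the Hilbert cube coordinates successively. The sections stay compact and nonempty, and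
  -- injectivity of `F` leaves a single point in the limit.
  let H : ℕ → Set (X × Y) := fun n => Nat.rec G (fun n S => sectionMinimizers (f n) S) n
  have Hsucc : ∀ n, H (n + 1) = sectionMinimizers (f n) (H n) := fun _ => rfl
  have hH : ∀ n, MeasurableSet (H n) ∧ (∀ x, IsCompact {y | (x, y) ∈ H n}) ∧
      ∀ x, {y | (x, y) ∈ H n}.Nonempty := by
    intro n
    induction n with
    | zero => exact ⟨hG, hcompact, hne⟩
    | succ n ih =>
      rw [Hsucc]
      exact ⟨measurableSet_sectionMinimizers (hf n) ih.1 ih.2.1,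
        fun x => isCompact_sectionMinimizers (hf n) (ih.2.1 x),
        fun x => nonempty_sectionMinimizers (hf n) (ih.2.1 x) (ih.2.2 x)⟩
  have hanti : ∀ n, H (n + 1) ⊆ H n := fun n p hp => hp.1
  have hex : ∀ x, ∃ y, ∀ n, (x, y) ∈ H n := by
    intro x
    obtain ⟨y, hy⟩ := IsCompact.nonempty_iInter_of_sequence_nonempty_isCompact_isClosed
      (fun n => {y | (x, y) ∈ H n}) (fun n y hy => hanti n hy) (fun n => (hH n).2.2 x)
      ((hH 0).2.1 x) (fun n => ((hH n).2.1 x).isClosed)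
    exact ⟨y, by simpa using hy⟩
  choose s hs using hex
  have huniq : ∀ x y, (∀ n, (x, y) ∈ H n) → y = s x := by
    intro x y hy
    refine hFi (funext fun n => Subtype.ext (le_antisymm ?_ ?_))
    · exact (hy (n + 1)).2 _ (hs x n)
    · exact (hs x (n + 1)).2 _ (hy n)
  refine ⟨s, measurable_of_isClosed fun C hC => ?_, fun x => hs x 0⟩
  -- By uniqueness the graph of `s` is `⋂ n, H n`, so preimages of closed sets are projections of
  -- Borel sets with compact sections.
  have hpre : s ⁻¹' C = Prod.fst '' ((⋂ n, H n) ∩ Set.univ ×ˢ C) := by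
    ext x
    constructor
    · exact fun hx => ⟨(x, s x), ⟨Set.mem_iInter.2 (hs x), trivial, hx⟩, rfl⟩
    · rintro ⟨⟨x', y⟩, ⟨hy, _, hyC⟩, rfl⟩
      have := huniq x' y (Set.mem_iInter.1 hy)
      exact this ▸ hyC
  rw [hpre]
  refine measurableSet_image_fst_of_isCompact_sections
    ((MeasurableSet.iInter fun n => (hH n).1).inter (MeasurableSet.univ.prod hC.measurableSet))
    fun x => ?_
  have : {y | (x, y) ∈ (⋂ n, H n) ∩ Set.univ ×ˢ C} = (⋂ n, {y | (x, y) ∈ H n}) ∩ C := by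
    ext y; simp
  rw [this]
  exact (((hH 0).2.1 x).of_isClosed_subset (isClosed_iInter fun n => ((hH n).2.1 x).isClosed)
    (Set.iInter_subset _ 0)).inter_right hC

end Projection

/-! ### Integrals over the complement of the target. -/

section ExtendZero

variable {X : Type*} {K : Set X}

/-- The extension by `0` to all of `X` of a function on `X ∖ K`. -/
def extendZero (u : (Kᶜ : Set X) → ℝ≥0∞) : X → ℝ≥0∞ :=
  Function.extend Subtype.val u 0

@[simp] lemma extendZero_coe (u : (Kᶜ : Set X) → ℝ≥0∞) (x : (Kᶜ : Set X)) :
    extendZero u x = u x :=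
  Subtype.val_injective.extend_apply _ _ _

lemma extendZero_of_mem (u : (Kᶜ : Set X) → ℝ≥0∞) {x : X} (hx : x ∈ K) :
    extendZero u x = 0 :=
  Function.extend_apply' _ _ _ (by rintro ⟨y, rfl⟩; exact y.2 hx)

variable [MeasurableSpace X]

lemma measurable_extendZero (hK : MeasurableSet K) {u : (Kᶜ : Set X) → ℝ≥0∞}
    (hu : Measurable u) : Measurable (extendZero u) :=
  (MeasurableEmbedding.subtype_coe hK.compl).measurable_extend hu measurable_const

lemma lintegral_comap_coe_compl (hK : MeasurableSet K) (μ : Measure X)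
    {u : (Kᶜ : Set X) → ℝ≥0∞} (hu : Measurable u) :
    ∫⁻ y, u y ∂(μ.comap (Subtype.val : (Kᶜ : Set X) → X)) = ∫⁻ y, extendZero u y ∂μ := by
  have hm := measurable_extendZero hK hu
  calc ∫⁻ y, u y ∂(μ.comap (Subtype.val : (Kᶜ : Set X) → X))
      = ∫⁻ y, extendZero u y.1 ∂(μ.comap (Subtype.val : (Kᶜ : Set X) → X)) := by simp
    _ = ∫⁻ y, extendZero u y ∂((μ.comap (Subtype.val : (Kᶜ : Set X) → X)).map Subtype.val) :=
      (lintegral_map hm measurable_subtype_coe).symm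
    _ = ∫⁻ y in Kᶜ, extendZero u y ∂μ := by rw [map_comap_subtype_coe hK.compl]
    _ = ∫⁻ y, extendZero u y ∂μ := by
      rw [← lintegral_indicator hK.compl]
      congr 1
      ext y
      by_cases hy : y ∈ K
      · simp [hy, extendZero_of_mem]
      · simp [hy]

end ExtendZero

/-! ### The dynamic programming operator: attainment, measurability, minimizers. -/

namespace MarkovControlModel

section Measurability

variable {X A : Type*} [MeasurableSpace X] [MeasurableSpace A] (M : MarkovControlModel X A)

lemma measurable_stageCost {K : Set X} (hK : MeasurableSet K) (α : ℝ)
    {u : (Kᶜ : Set X) → ℝ≥0∞} (hu : Measurable u) : Measurable (M.stageCost K α u) := by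
  unfold stageCost
  simp_rw [lintegral_comap_coe_compl hK _ hu]
  exact M.measurable_c.ennreal_ofReal.add
    ((measurable_extendZero hK hu).lintegral_kernel.const_mul _)

lemma stageCost_mono {K : Set X} {α : ℝ} {u u' : (Kᶜ : Set X) → ℝ≥0∞} (h : u ≤ u')
    (p : M.pairs) : M.stageCost K α u p ≤ M.stageCost K α u' p := by
  unfold stageCost
  gcongr
  exact h _

lemma T_le_stageCost {K : Set X} {α : ℝ} (u : (Kᶜ : Set X) → ℝ≥0∞) (x : (Kᶜ : Set X)) {a : A}
    (ha : a ∈ M.feasible x) : M.T K α u x ≤ M.stageCost K α u ⟨((x : X), a), ha⟩ :=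
  iInf_le (fun a : M.feasible x => M.stageCost K α u ⟨((x : X), (a : A)), a.2⟩) ⟨a, ha⟩

lemma T_mono {K : Set X} {α : ℝ} {u u' : (Kᶜ : Set X) → ℝ≥0∞} (h : u ≤ u') :
    M.T K α u ≤ M.T K α u' :=
  fun _ => iInf_mono fun _ => M.stageCost_mono h _

/-- The feasible pairs with state outside `K` whose stage cost is at most `r`. -/
def stageLevel (K : Set X) (α : ℝ) (u r : (Kᶜ : Set X) → ℝ≥0∞) : Set ((Kᶜ : Set X) × A) :=
  {p | ∃ h : p.2 ∈ M.feasible p.1, M.stageCost K α u ⟨((p.1 : X), p.2), h⟩ ≤ r p.1}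

lemma measurableSet_stageLevel {K : Set X} (hK : MeasurableSet K) (α : ℝ)
    {u r : (Kᶜ : Set X) → ℝ≥0∞} (hu : Measurable u) (hr : Measurable r) :
    MeasurableSet (M.stageLevel K α u r) := by
  have hι : Measurable (fun p : (Kᶜ : Set X) × A => ((p.1 : X), p.2)) := by fun_prop
  have hS : MeasurableSet {p : (Kᶜ : Set X) × A | p.2 ∈ M.feasible p.1} :=
    hι M.measurableSet_pairs
  have hm : Measurable fun q : {p : (Kᶜ : Set X) × A | p.2 ∈ M.feasible p.1} =>
      M.stageCost K α u ⟨((q.1.1 : X), q.1.2), q.2⟩ :=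
    (M.measurable_stageCost hK α hu).comp
      ((hι.comp measurable_subtype_coe).subtype_mk (h := fun q => q.2))
  have hm' : Measurable fun q : {p : (Kᶜ : Set X) × A | p.2 ∈ M.feasible p.1} => r q.1.1 := by
    fun_prop
  convert hS.subtype_image (measurableSet_le hm hm') using 1
  ext p
  simp only [stageLevel, Set.mem_ofPred_eq, Set.mem_image, Subtype.exists, exists_and_right,
    exists_eq_right]
  exact Iff.rfl

end Measurability

/-- The compactness and continuity assumptions on the model outside the target set `K`. -/
structure IsRegularOff {X A : Type*} [MeasurableSpace X] [MeasurableSpace A]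
    [TopologicalSpace X] [TopologicalSpace A] (M : MarkovControlModel X A) (K : Set X) :
    Prop where
  measurableSet_target : MeasurableSet K
  isCompact_feasible : ∀ x, x ∉ K → IsCompact (M.feasible x)
  lowerSemicontinuousOn_c : LowerSemicontinuousOn M.c (M.pairsOff K)
  stronglyFeller : M.StronglyFeller K

variable {X A : Type*} [MeasurableSpace X] [MeasurableSpace A]
  [TopologicalSpace X] [TopologicalSpace A] {M : MarkovControlModel X A} {K : Set X}

/-- The truncations `min u n` are bounded, so their integrals are continuous in the pair. By
monotone convergence the integral of `u` is the supremum of these. -/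
lemma StronglyFeller.lowerSemicontinuousOn_lintegral (h : M.StronglyFeller K) {u : X → ℝ≥0∞}
    (hu : Measurable u) :
    LowerSemicontinuousOn (fun p : M.pairs => ∫⁻ y, u y ∂(M.Q p)) (M.pairsOff K) := by
  have : ∀ p : M.pairs, IsProbabilityMeasure (M.Q p) :=
    M.isMarkovKernel_Q.isProbabilityMeasure
  have hfin : ∀ (n : ℕ) y, min (u y) (n : ℝ≥0∞) ≠ ⊤ := fun n y =>
    ((min_le_right _ _).trans_lt (ENNReal.natCast_lt_top n)).ne
  have hmeas : ∀ n : ℕ, Measurable fun y => min (u y) (n : ℝ≥0∞) := fun n => by fun_prop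
  have hbound : ∀ (n : ℕ) y, |(min (u y) (n : ℝ≥0∞)).toReal| ≤ n := fun n y => by
    rw [abs_of_nonneg ENNReal.toReal_nonneg]
    exact ENNReal.toReal_le_of_le_ofReal (Nat.cast_nonneg n)
      ((min_le_right _ _).trans_eq (ENNReal.ofReal_natCast n).symm)
  have htrunc : ∀ n : ℕ, LowerSemicontinuousOn
      (fun p : M.pairs => ∫⁻ y, min (u y) n ∂(M.Q p)) (M.pairsOff K) := by
    intro n
    have hcont := h (fun y => (min (u y) (n : ℝ≥0∞)).toReal) (hmeas n).ennreal_toReal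
      ⟨n, hbound n⟩
    have heq : (fun p : M.pairs => ∫⁻ y, min (u y) (n : ℝ≥0∞) ∂(M.Q p)) =
        fun p => ENNReal.ofReal (∫ y, (min (u y) (n : ℝ≥0∞)).toReal ∂(M.Q p)) := by
      funext p
      rw [ofReal_integral_eq_lintegral_ofReal]
      · exact lintegral_congr fun y => (ENNReal.ofReal_toReal (hfin n y)).symm
      · exact Integrable.of_bound (hmeas n).ennreal_toReal.aestronglyMeasurable n
          (Filter.Eventually.of_forall fun y => hbound n y)
      · exact Filter.Eventually.of_forall fun y => ENNReal.toReal_nonneg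
    rw [heq]
    exact (ENNReal.continuous_ofReal.comp_continuousOn hcont).lowerSemicontinuousOn
  have heq : (fun p : M.pairs => ∫⁻ y, u y ∂(M.Q p)) =
      fun p => ⨆ n : ℕ, ∫⁻ y, min (u y) (n : ℝ≥0∞) ∂(M.Q p) := by
    funext p
    rw [← lintegral_iSup hmeas]
    · refine lintegral_congr fun y => ?_
      have := inf_iSup_eq (u y) (fun n : ℕ => (n : ℝ≥0∞))
      rw [ENNReal.iSup_natCast, inf_top_eq] at this
      exact this
    · intro m n hmn y
      exact min_le_min_left _ (by exact_mod_cast hmn)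
  rw [heq]
  exact lowerSemicontinuousOn_iSup htrunc

namespace IsRegularOff

lemma lowerSemicontinuousOn_stageCost (h : M.IsRegularOff K) (α : ℝ)
    {u : (Kᶜ : Set X) → ℝ≥0∞} (hu : Measurable u) :
    LowerSemicontinuousOn (M.stageCost K α u) (M.pairsOff K) := by
  unfold stageCost
  simp_rw [lintegral_comap_coe_compl h.measurableSet_target _ hu]
  refine LowerSemicontinuousOn.add ?_ ?_
  · exact ENNReal.continuous_ofReal.comp_lowerSemicontinuousOn h.lowerSemicontinuousOn_c
      ENNReal.ofReal_mono
  · exact (ENNReal.continuous_const_mul ENNReal.ofReal_ne_top).comp_lowerSemicontinuousOn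
      (h.stronglyFeller.lowerSemicontinuousOn_lintegral
        (measurable_extendZero h.measurableSet_target hu)) fun _ _ hab => mul_le_mul' le_rfl hab

lemma lowerSemicontinuous_stageCost_section (h : M.IsRegularOff K) (α : ℝ)
    {u : (Kᶜ : Set X) → ℝ≥0∞} (hu : Measurable u) (x : (Kᶜ : Set X)) :
    LowerSemicontinuous fun a : M.feasible x =>
      M.stageCost K α u ⟨((x : X), (a : A)), a.2⟩ := by
  rw [← lowerSemicontinuousOn_univ_iff]
  have hc : Continuous fun a : M.feasible x => (⟨((x : X), (a : A)), a.2⟩ : M.pairs) :=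
    (continuous_const.prodMk continuous_subtype_val).subtype_mk _
  exact (h.lowerSemicontinuousOn_stageCost α hu).comp hc.continuousOn fun a _ => x.2

lemma isMinStage_T (h : M.IsRegularOff K) (α : ℝ) {u : (Kᶜ : Set X) → ℝ≥0∞}
    (hu : Measurable u) (x : (Kᶜ : Set X)) : M.IsMinStage K α u x (M.T K α u x) := by
  have := isCompact_iff_compactSpace.1 (h.isCompact_feasible x x.2)
  have := (M.feasible_nonempty x).to_subtype
  obtain ⟨a, -, ha⟩ := ((lowerSemicontinuousOn_univ_iff.2
    (h.lowerSemicontinuous_stageCost_section α hu x))).exists_isMinOn Set.univ_nonempty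
      isCompact_univ
  refine ⟨⟨a, le_antisymm (le_iInf fun b => ha (Set.mem_univ b)) (iInf_le _ a)⟩, ?_⟩
  rintro _ ⟨b, rfl⟩
  exact iInf_le _ b

lemma isCompact_stageLevel [T2Space A] (h : M.IsRegularOff K) (α : ℝ)
    {u : (Kᶜ : Set X) → ℝ≥0∞} (hu : Measurable u) (r : (Kᶜ : Set X) → ℝ≥0∞)
    (x : (Kᶜ : Set X)) : IsCompact {a | (x, a) ∈ M.stageLevel K α u r} := by
  have := isCompact_iff_compactSpace.1 (h.isCompact_feasible x x.2)
  have hcl := (h.lowerSemicontinuous_stageCost_section α hu x).isClosed_preimage (r x)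
  convert hcl.isCompact.image continuous_subtype_val using 1
  ext a
  simp [stageLevel]

variable [StandardBorelSpace X] [TopologicalSpace.MetrizableSpace A] [SecondCountableTopology A]
  [BorelSpace A] [StandardBorelSpace A]

/-- Because the infimum is attained, `{T u ≤ r}` is exactly the projection of the sublevel set of
the stage cost. -/
lemma measurable_T (h : M.IsRegularOff K) (α : ℝ) {u : (Kᶜ : Set X) → ℝ≥0∞}
    (hu : Measurable u) : Measurable (M.T K α u) := by
  have := h.measurableSet_target.compl.standardBorel
  refine measurable_of_Iic fun r => ?_
  have heq : M.T K α u ⁻¹' Set.Iic r = Prod.fst '' M.stageLevel K α u fun _ => r := by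
    ext x
    constructor
    · intro hx
      obtain ⟨a, ha⟩ := (h.isMinStage_T α hu x).1
      exact ⟨(x, a), ⟨a.2, ha.le.trans hx⟩, rfl⟩
    · rintro ⟨⟨x, a⟩, ⟨ha, hle⟩, rfl⟩
      exact (M.T_le_stageCost u x ha).trans hle
  rw [heq]
  exact measurableSet_image_fst_of_isCompact_sections
    (M.measurableSet_stageLevel h.measurableSet_target α hu measurable_const)
    (h.isCompact_stageLevel α hu _)

/-- The stage level set with `r = T u` has the sets of minimizing actions as sections. On `K`, where
nothing is minimized, the given selector completes the choice. -/
lemma exists_measurable_minimizer (h : M.IsRegularOff K) (hsel : M.HasMeasurableSelector) (α : ℝ)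
    {u : (Kᶜ : Set X) → ℝ≥0∞} (hu : Measurable u) :
    ∃ f : X → A, Measurable f ∧ ∃ hf : ∀ x, f x ∈ M.feasible x, ∀ x : (Kᶜ : Set X),
      M.stageCost K α u ⟨((x : X), f x), hf x⟩ = M.T K α u x := by
  have hK := h.measurableSet_target
  have := hK.compl.standardBorel
  obtain ⟨g, hg, hgmem⟩ := exists_measurable_selector_of_isCompact_sections
    (M.measurableSet_stageLevel hK α hu (h.measurable_T α hu))
    (h.isCompact_stageLevel α hu _) fun x => by
      obtain ⟨a, ha⟩ := (h.isMinStage_T α hu x).1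
      exact ⟨a, a.2, ha.le⟩
  obtain ⟨f₀, hf₀, hf₀mem⟩ := hsel
  have hext : ∀ x : (Kᶜ : Set X), Function.extend Subtype.val g f₀ x = g x := fun x =>
    Subtype.val_injective.extend_apply _ _ _
  refine ⟨Function.extend Subtype.val g f₀,
    (MeasurableEmbedding.subtype_coe hK.compl).measurable_extend hg hf₀, fun x => ?_, fun x => ?_⟩
  · by_cases hx : x ∈ K
    · rw [Function.extend_apply' _ _ _ (by rintro ⟨y, rfl⟩; exact y.2 hx)]
      exact hf₀mem x
    · rw [hext ⟨x, hx⟩]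
      exact (hgmem ⟨x, hx⟩).1
  · obtain ⟨hmem, hle⟩ := hgmem x
    simp only [hext]
    exact le_antisymm hle (M.T_le_stageCost u x hmem)

lemma measurable_valueIter (h : M.IsRegularOff K) (α : ℝ) (n : ℕ) :
    Measurable (M.valueIter K α n) := by
  induction n with
  | zero => exact measurable_const
  | succ n ih => exact h.measurable_T α ih

end IsRegularOff

end MarkovControlModel

/-! ### The controlled process and the costs of policies. -/

namespace MarkovControlModel

variable {X A : Type*} [MeasurableSpace X] [MeasurableSpace A]

/-- The trajectories that avoid `K` up to and including time `n`. -/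
def survival {X A : Type*} (K : Set X) (n : ℕ) : Set (ℕ → X × A) := {ω | ∀ i ≤ n, (ω i).1 ∉ K}

lemma natCast_lt_hitTime_iff {X A : Type*} {K : Set X} {n : ℕ} {ω : ℕ → X × A} :
    (n : ℕ∞) < hitTime K ω ↔ ω ∈ survival K n := by
  constructor
  · intro h i hi hK
    have : hitTime K ω ≤ i := iInf₂_le i hK
    exact absurd (h.trans_le this) (by simpa using hi)
  · intro h
    have : ((n + 1 : ℕ) : ℕ∞) ≤ hitTime K ω := le_iInf₂ fun i hi => by
      by_contra! hlt
      exact h i (Nat.lt_succ_iff.1 (by exact_mod_cast hlt)) hi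
    exact lt_of_lt_of_le (by exact_mod_cast Nat.lt_succ_self n) this

lemma measurableSet_survival {K : Set X} (hK : MeasurableSet K) (n : ℕ) :
    MeasurableSet (survival K n : Set (ℕ → X × A)) := by
  have : (survival K n : Set (ℕ → X × A)) = ⋂ (i) (_ : i ≤ n), {ω | (ω i).1 ∈ Kᶜ} := by
    ext ω
    simp [survival]
  rw [this]
  refine MeasurableSet.iInter fun i => MeasurableSet.iInter fun _ => ?_
  exact (show Measurable fun ω : ℕ → X × A => (ω i).1 by fun_prop) hK.compl

variable {M : MarkovControlModel X A}

lemma measurable_cext : Measurable M.cext := by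
  classical
  exact Measurable.dite (s := M.pairs) (f := fun p => M.c p) (g := fun _ => 0) M.measurable_c
    measurable_const M.measurableSet_pairs

lemma cext_of_mem {p : X × A} (h : p ∈ M.pairs) : M.cext p = M.c ⟨p, h⟩ := dif_pos h

namespace Policy

variable (π : M.Policy) (x : X)

instance (i : ℕ) : IsMarkovKernel (π.φ i) := π.isMarkovKernel_φ i

instance : IsProbabilityMeasure (π.law x) := by
  unfold law
  infer_instance

lemma lintegral_law_zero {G : X × A → ℝ≥0∞} (hG : Measurable G) :
    ∫⁻ ω, G (ω 0) ∂(π.law x) = ∫⁻ a, G (x, a) ∂(π.φ 0 x) := by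
  have hmap : (π.law x).map (Preorder.frestrictLe 0) =
      (Measure.dirac x ⊗ₘ π.φ 0).map
        (MeasurableEquiv.piUnique (fun _ : Finset.Iic 0 => X × A)).symm := by
    rw [law, Kernel.trajMeasure, Measure.map_comp _ _ (by fun_prop), Kernel.traj_map_frestrictLe,
      Kernel.partialTraj_self, Measure.id_comp]
  calc ∫⁻ ω, G (ω 0) ∂(π.law x)
      = ∫⁻ z, G (z ⟨0, by simp⟩) ∂((π.law x).map (Preorder.frestrictLe 0)) := by
        rw [lintegral_map (by fun_prop) (by fun_prop)]
        rfl
    _ = ∫⁻ p, G p ∂(Measure.dirac x ⊗ₘ π.φ 0) := by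
        rw [hmap, lintegral_map (by fun_prop) (by fun_prop)]
        rfl
    _ = ∫⁻ a, G (x, a) ∂(π.φ 0 x) := by
        rw [Measure.lintegral_compProd hG, lintegral_dirac' _ (by fun_prop)]

lemma lintegral_step (n : ℕ) (z : Finset.Iic n → X × A) {G : X × A → ℝ≥0∞} (hG : Measurable G) :
    ∫⁻ p, G p ∂(π.step n z) =
      ∫⁻ y, ∫⁻ a, G (y, a) ∂(π.φ (n + 1) y) ∂(M.Qext (z ⟨n, Finset.mem_Iic.2 le_rfl⟩)) := by
  rw [step, Kernel.comap_apply, Kernel.lintegral_compProd _ _ _ hG]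
  rfl

lemma setLIntegral_survival_zero {K : Set X} (hK : MeasurableSet K) (hx : x ∉ K)
    {h : X × A → ℝ≥0∞} (hh : Measurable h) :
    ∫⁻ ω in survival K 0, h (ω 0) ∂(π.law x) = ∫⁻ a, h (x, a) ∂(π.φ 0 x) := by
  have hm : MeasurableSet {p : X × A | p.1 ∈ Kᶜ} := measurable_fst hK.compl
  rw [← lintegral_indicator (measurableSet_survival hK 0)]
  have heq : (survival K 0).indicator (fun ω : ℕ → X × A => h (ω 0)) =
      fun ω => {p : X × A | p.1 ∈ Kᶜ}.indicator h (ω 0) := by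
    funext ω
    by_cases hω : (ω 0).1 ∈ K <;> simp [survival, hω, Set.indicator]
  rw [heq, π.lintegral_law_zero x (hh.indicator hm)]
  simp [Set.indicator, hx]

/-- Markov property: survival up to `n` depends only on the history, so conditioning on it leaves
one transition and one decision to integrate. -/
lemma setLIntegral_survival_succ {K : Set X} (hK : MeasurableSet K) (n : ℕ)
    {h : X × A → ℝ≥0∞} (hh : Measurable h) :
    ∫⁻ ω in survival K (n + 1), h (ω (n + 1)) ∂(π.law x) =
      ∫⁻ ω in survival K n, ∫⁻ y in Kᶜ, ∫⁻ a, h (y, a) ∂(π.φ (n + 1) y) ∂(M.Qext (ω n))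
        ∂(π.law x) := by
  have hm : MeasurableSet {p : X × A | p.1 ∈ Kᶜ} := measurable_fst hK.compl
  let S : Set (Finset.Iic n → X × A) := {z | ∀ i, (z i).1 ∈ Kᶜ}
  have hS : MeasurableSet S := by
    have : S = ⋂ i, {z | (z i).1 ∈ Kᶜ} := by ext z; simp [S]
    rw [this]
    exact MeasurableSet.iInter fun i =>
      (show Measurable fun z : Finset.Iic n → X × A => (z i).1 by fun_prop) hK.compl
  have hSω : ∀ ω : ℕ → X × A, Preorder.frestrictLe n ω ∈ S ↔ ω ∈ survival K n := by
    intro ω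
    exact ⟨fun H i hi => H ⟨i, Finset.mem_Iic.2 hi⟩, fun H i => H i (Finset.mem_Iic.1 i.2)⟩
  have hg : Measurable ({p : X × A | p.1 ∈ Kᶜ}.indicator h) := hh.indicator hm
  have hF : Measurable fun q : (Finset.Iic n → X × A) × (X × A) =>
      S.indicator 1 q.1 * {p : X × A | p.1 ∈ Kᶜ}.indicator h q.2 :=
    ((measurable_one.indicator hS).comp measurable_fst).mul (hg.comp measurable_snd)
  -- The joint law of the history up to `n` and the next pair is the history law composed with
  -- `π.step n`; integrating a product of indicator-type functions against it gives both sides.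
  have key := Kernel.map_frestrictLe_trajMeasure_compProd_eq_map_trajMeasure
    (X := fun _ => X × A) (μ₀ := (Measure.dirac x) ⊗ₘ (π.φ 0)) (κ := π.step) (a := n)
  change (π.law x).map (Preorder.frestrictLe n) ⊗ₘ π.step n = (π.law x).map _ at key
  have hint := congrArg (fun μ => ∫⁻ q, S.indicator 1 q.1 *
    {p : X × A | p.1 ∈ Kᶜ}.indicator h q.2 ∂μ) key
  have : IsProbabilityMeasure ((π.law x).map (Preorder.frestrictLe (π := fun _ => X × A) n)) :=
    Measure.isProbabilityMeasure_map (by fun_prop)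
  rw [Measure.lintegral_compProd hF, lintegral_map hF (by fun_prop),
    lintegral_map hF.lintegral_kernel_prod_right' (by fun_prop)] at hint
  rw [← lintegral_indicator (measurableSet_survival hK _),
    ← lintegral_indicator (measurableSet_survival hK _)]
  refine Eq.trans (lintegral_congr fun ω => ?_) (hint.symm.trans (lintegral_congr fun ω => ?_))
  · have hsucc : ω ∈ survival K (n + 1) ↔ ω ∈ survival K n ∧ (ω (n + 1)).1 ∈ Kᶜ := by
      constructor
      · exact fun H => ⟨fun i hi => H i (by omega), H _ le_rfl⟩
      · rintro ⟨H, H'⟩ i hi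
        rcases Nat.le_succ_iff.1 hi with hi | rfl
        exacts [H i hi, H']
    by_cases h1 : ω ∈ survival K n <;> by_cases h2 : (ω (n + 1)).1 ∈ Kᶜ <;>
      simp [Set.indicator, hSω, hsucc, h1] <;> simp_all
  · dsimp only
    rw [lintegral_const_mul _ hg, π.lintegral_step n _ hg]
    by_cases h1 : ω ∈ survival K n
    · simp only [Set.indicator, hSω, h1, if_true, Pi.one_apply, one_mul]
      rw [← lintegral_indicator hK.compl]
      refine lintegral_congr fun y => ?_
      by_cases hy : y ∈ K <;> simp [Set.indicator, hy]
    · simp [Set.indicator, hSω, h1]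

/-- A property of state-action pairs that holds almost surely under every decision kernel holds
almost surely along the controlled process. -/
lemma ae_law_mem {B : Set (X × A)} (hB : MeasurableSet B)
    (h : ∀ n y, ∀ᵐ a ∂(π.φ n y), (y, a) ∈ B) (n : ℕ) : ∀ᵐ ω ∂(π.law x), ω n ∈ B := by
  have hω : Measurable fun ω : ℕ → X × A => ω n := by fun_prop
  have hzero : ∀ m y, ∫⁻ a, Bᶜ.indicator 1 (y, a) ∂(π.φ m y) = 0 := by
    intro m y
    have hm : Measurable fun a => Bᶜ.indicator (1 : X × A → ℝ≥0∞) (y, a) :=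
      (measurable_one.indicator hB.compl).comp measurable_prodMk_left
    rw [lintegral_eq_zero_iff hm]
    filter_upwards [h m y] with a ha
    simp [ha]
  -- With empty target every trajectory survives, so the survival identities describe the plain
  -- marginals.
  have huniv : ∀ m, (survival (∅ : Set X) m : Set (ℕ → X × A)) = Set.univ := fun m => by
    ext; simp [survival]
  have hind : Measurable (Bᶜ.indicator (1 : X × A → ℝ≥0∞)) := measurable_one.indicator hB.compl
  have hint : ∫⁻ ω, Bᶜ.indicator 1 (ω n) ∂(π.law x) = 0 := by
    rw [← setLIntegral_univ, ← huniv n]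
    cases n with
    | zero =>
      rw [π.setLIntegral_survival_zero x MeasurableSet.empty (Set.notMem_empty x) hind]
      exact hzero 0 x
    | succ n =>
      rw [π.setLIntegral_survival_succ x MeasurableSet.empty n hind]
      simp [hzero]
  have hind' : Measurable fun ω : ℕ → X × A => Bᶜ.indicator (1 : X × A → ℝ≥0∞) (ω n) :=
    hind.comp hω
  rw [lintegral_eq_zero_iff hind'] at hint
  filter_upwards [hint] with ω hω
  by_contra hn
  simp [hn] at hω

lemma ae_law_mem_pairs (n : ℕ) : ∀ᵐ ω ∂(π.law x), ω n ∈ M.pairs :=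
  π.ae_law_mem x M.measurableSet_pairs (fun n y =>
    (prob_compl_eq_zero_iff (M.measurableSet_feasible y)).2 (π.φ_feasible n y)) n

/-- The expected undiscounted cost incurred at time `n`, before hitting `K`. -/
def expectedCostAt (K : Set X) (n : ℕ) : ℝ≥0∞ :=
  ∫⁻ ω in survival K n, ENNReal.ofReal (M.cext (ω n)) ∂(π.law x)

/-- The expectation of `u(x_n)` on the event that `K` has not been hit by time `n`. -/
def expectedValueAt (K : Set X) (u : (Kᶜ : Set X) → ℝ≥0∞) (n : ℕ) : ℝ≥0∞ :=
  ∫⁻ ω in survival K n, extendZero u (ω n).1 ∂(π.law x)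

lemma cost_eq_tsum {K : Set X} (hK : MeasurableSet K) {α : ℝ} (hα : 0 ≤ α) :
    π.cost K α x = ∑' i, ENNReal.ofReal α ^ i * π.expectedCostAt x K i := by
  have hc : ∀ i, Measurable fun ω : ℕ → X × A => ENNReal.ofReal (M.cext (ω i)) := fun i =>
    (measurable_cext.comp (measurable_pi_apply i)).ennreal_ofReal
  have hterm : ∀ (i : ℕ) (ω : ℕ → X × A),
      (open Classical in if (i : ℕ∞) < hitTime K ω then
        ENNReal.ofReal (α ^ i * M.cext (ω i)) else 0) =
      (survival K i).indicator
        (fun ω => ENNReal.ofReal α ^ i * ENNReal.ofReal (M.cext (ω i))) ω := by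
    intro i ω
    by_cases h : ω ∈ survival K i
    · rw [Set.indicator_of_mem h, if_pos (natCast_lt_hitTime_iff.2 h),
        ENNReal.ofReal_mul (pow_nonneg hα i), ENNReal.ofReal_pow hα]
    · rw [Set.indicator_of_notMem h, if_neg (mt natCast_lt_hitTime_iff.1 h)]
  unfold cost
  simp_rw [hterm]
  rw [lintegral_tsum fun i =>
    (((hc i).const_mul _).indicator (measurableSet_survival hK i)).aemeasurable]
  refine tsum_congr fun i => ?_
  rw [lintegral_indicator (measurableSet_survival hK i), lintegral_const_mul _ (hc i)]
  rfl

lemma expectedValueAt_zero {K : Set X} (hK : MeasurableSet K) {u : (Kᶜ : Set X) → ℝ≥0∞}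
    (hu : Measurable u) (x : (Kᶜ : Set X)) : π.expectedValueAt x K u 0 = u x := by
  have hm := measurable_extendZero hK hu
  rw [expectedValueAt, π.setLIntegral_survival_zero (h := fun p => extendZero u p.1) x hK x.2
    (hm.comp measurable_fst)]
  simp

lemma expectedValueAt_succ {K : Set X} (hK : MeasurableSet K) {u : (Kᶜ : Set X) → ℝ≥0∞}
    (hu : Measurable u) (n : ℕ) : π.expectedValueAt x K u (n + 1) =
      ∫⁻ ω in survival K n, ∫⁻ y, extendZero u y ∂(M.Qext (ω n)) ∂(π.law x) := by
  have hm := measurable_extendZero hK hu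
  rw [expectedValueAt, π.setLIntegral_survival_succ (h := fun p => extendZero u p.1) x hK n
    (hm.comp measurable_fst)]
  refine lintegral_congr fun ω => ?_
  rw [← lintegral_indicator hK.compl]
  refine lintegral_congr fun y => ?_
  by_cases hy : y ∈ K
  · simp [hy, extendZero_of_mem]
  · simp [hy]

/-- The one-step expected stage cost, written as an integral of `c + α ∫ u dQ` along the process. -/
lemma expectedCostAt_add {K : Set X} (hK : MeasurableSet K) (α : ℝ)
    {u : (Kᶜ : Set X) → ℝ≥0∞} (hu : Measurable u) (n : ℕ) :
    π.expectedCostAt x K n + ENNReal.ofReal α * π.expectedValueAt x K u (n + 1) =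
      ∫⁻ ω in survival K n, (ENNReal.ofReal (M.cext (ω n)) +
        ENNReal.ofReal α * ∫⁻ y, extendZero u y ∂(M.Qext (ω n))) ∂(π.law x) := by
  have hm := measurable_extendZero hK hu
  have hω : Measurable fun ω : ℕ → X × A => ω n := by fun_prop
  have hint : Measurable fun ω : ℕ → X × A => ∫⁻ y, extendZero u y ∂(M.Qext (ω n)) :=
    (hm.lintegral_kernel (κ := M.Qext)).comp hω
  have hc : Measurable fun ω : ℕ → X × A => ENNReal.ofReal (M.cext (ω n)) :=
    (measurable_cext.comp hω).ennreal_ofReal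
  rw [lintegral_add_left hc, lintegral_const_mul _ hint,
    π.expectedValueAt_succ x hK hu]
  rfl

lemma stageCost_eq_ext {K : Set X} (hK : MeasurableSet K) (α : ℝ)
    {u : (Kᶜ : Set X) → ℝ≥0∞} (hu : Measurable u) {p : X × A} (hp : p ∈ M.pairs) :
    M.stageCost K α u ⟨p, hp⟩ = ENNReal.ofReal (M.cext p) +
      ENNReal.ofReal α * ∫⁻ y, extendZero u y ∂(M.Qext p) := by
  rw [stageCost, lintegral_comap_coe_compl hK _ hu, cext_of_mem hp, M.Qext_of_mem hp]
  rfl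

/-- Almost surely the played action is feasible, so its stage cost bounds the infimum from above. -/
lemma expectedValueAt_le_of_le_T {K : Set X} (hK : MeasurableSet K) {α : ℝ}
    {u u' : (Kᶜ : Set X) → ℝ≥0∞} (hu : Measurable u) (h : u' ≤ M.T K α u) (n : ℕ) :
    π.expectedValueAt x K u' n ≤
      π.expectedCostAt x K n + ENNReal.ofReal α * π.expectedValueAt x K u (n + 1) := by
  rw [π.expectedCostAt_add x hK α hu, expectedValueAt]
  refine lintegral_mono_ae ?_
  filter_upwards [ae_restrict_of_ae (π.ae_law_mem_pairs x n),
    ae_restrict_mem (measurableSet_survival hK n)] with ω hp hs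
  rw [← stageCost_eq_ext hK α hu hp]
  have hx : (ω n).1 ∈ Kᶜ := hs n le_rfl
  have := extendZero_coe u' ⟨(ω n).1, hx⟩
  dsimp only at this
  rw [this]
  exact (h _).trans (M.T_le_stageCost u ⟨(ω n).1, hx⟩ hp)

lemma valueIter_le_cost {K : Set X} (hK : MeasurableSet K) {α : ℝ} (hα : 0 ≤ α)
    (hm : ∀ n, Measurable (M.valueIter K α n)) (N : ℕ) (x : (Kᶜ : Set X)) :
    M.valueIter K α N x ≤ π.cost K α x := by
  -- The induction on the horizon needs an arbitrary starting time `n`, since each step moves it to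
  -- `n + 1`.
  have key : ∀ N n, π.expectedValueAt x K (M.valueIter K α N) n ≤
      ∑ i ∈ Finset.range N, ENNReal.ofReal α ^ i * π.expectedCostAt x K (n + i) := by
    intro N
    induction N with
    | zero =>
      intro n
      have : extendZero (M.valueIter K α 0) = 0 := by
        funext y
        by_cases hy : y ∈ K
        · exact extendZero_of_mem _ hy
        · exact extendZero_coe (M.valueIter K α 0) ⟨y, hy⟩
      simp [expectedValueAt, this]
    | succ N ih =>
      intro n
      refine (π.expectedValueAt_le_of_le_T x hK (hm N) le_rfl n).trans ?_
      rw [Finset.sum_range_succ', add_comm]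
      gcongr
      · refine (mul_le_mul' le_rfl (ih (n + 1))).trans_eq ?_
        rw [Finset.mul_sum]
        refine Finset.sum_congr rfl fun i _ => ?_
        rw [pow_succ', mul_assoc, add_right_comm, add_assoc]
      · simp
  rw [← π.expectedValueAt_zero hK (hm N) x, π.cost_eq_tsum x hK hα]
  refine (key N 0).trans ?_
  simp only [zero_add]
  exact ENNReal.sum_le_tsum _

/-- The stationary deterministic policy that always plays `f`. -/
def stationary {f : X → A} (hf : Measurable f) (hmem : ∀ x, f x ∈ M.feasible x) : M.Policy where
  φ _ := Kernel.deterministic f hf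
  isMarkovKernel_φ _ := inferInstance
  φ_feasible _ x := by
    rw [Kernel.deterministic_apply' _ _ (M.measurableSet_feasible x)]
    simp [hmem x]

/-- The hypothesis says that cost now plus discounted expected `u` later is at most `u` now.
Iterating and dropping the nonnegative terminal term bounds every partial sum of the cost, without
any finiteness of `u`. -/
lemma cost_stationary_le [MeasurableEq A] {K : Set X} (hK : MeasurableSet K) {α : ℝ} (hα : 0 ≤ α)
    {u : (Kᶜ : Set X) → ℝ≥0∞} (hu : Measurable u)
    {f : X → A} (hf : Measurable f) (hmem : ∀ x, f x ∈ M.feasible x)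
    (h : ∀ x : (Kᶜ : Set X), M.stageCost K α u ⟨((x : X), f x), hmem x⟩ ≤ u x)
    (x : (Kᶜ : Set X)) : (stationary hf hmem).cost K α x ≤ u x := by
  set π := stationary hf hmem with hπ
  have hgraph : ∀ n, ∀ᵐ ω ∂(π.law x), (ω n).2 = f (ω n).1 := fun n => by
    have hB : MeasurableSet {p : X × A | p.2 = f p.1} :=
      measurableSet_eq_fun measurable_snd (hf.comp measurable_fst)
    refine π.ae_law_mem x hB (fun n y => ?_) n
    change ∀ᵐ a ∂(Kernel.deterministic f hf y), a = f y
    have hs : MeasurableSet {a | a = f y} := measurableSet_eq_fun measurable_id measurable_const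
    rw [Kernel.deterministic_apply, ae_dirac_iff hs]
  have hstep : ∀ n, π.expectedCostAt x K n +
      ENNReal.ofReal α * π.expectedValueAt x K u (n + 1) ≤ π.expectedValueAt x K u n := by
    intro n
    rw [π.expectedCostAt_add x hK α hu, expectedValueAt]
    refine lintegral_mono_ae ?_
    filter_upwards [ae_restrict_of_ae (hgraph n),
      ae_restrict_mem (measurableSet_survival hK n)] with ω hp hs
    have hx : (ω n).1 ∈ Kᶜ := hs n le_rfl
    have hω : ω n = ((ω n).1, f (ω n).1) := Prod.ext rfl hp
    have := h ⟨(ω n).1, hx⟩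
    rw [stageCost_eq_ext hK α hu (hmem _)] at this
    rw [hω]
    refine this.trans_eq ?_
    exact (extendZero_coe u ⟨(ω n).1, hx⟩).symm
  have key : ∀ N n, ∑ i ∈ Finset.range N, ENNReal.ofReal α ^ i * π.expectedCostAt x K (n + i) ≤
      π.expectedValueAt x K u n := by
    intro N
    induction N with
    | zero => simp
    | succ N ih =>
      intro n
      refine le_trans ?_ (hstep n)
      rw [Finset.sum_range_succ', add_comm]
      gcongr
      · simp
      · refine Eq.trans_le ?_ (mul_le_mul' le_rfl (ih (n + 1)))
        rw [Finset.mul_sum]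
        refine Finset.sum_congr rfl fun i _ => ?_
        rw [pow_succ', mul_assoc, add_right_comm, add_assoc]
  rw [← π.expectedValueAt_zero hK hu x, π.cost_eq_tsum x hK hα]
  refine ENNReal.tsum_le_of_sum_range_le fun N => ?_
  simpa using key N 0

end Policy

end MarkovControlModel

/-! ### The weighted norm through pointwise inequalities in `ℝ≥0∞`. -/

section WeightedNorm

lemma abs_coe_ennreal (a : ℝ≥0∞) : (a : EReal).abs = a := by
  induction a with
  | top => rfl
  | coe a => rw [EReal.coe_nnreal_eq_coe_real, EReal.abs_def, abs_of_nonneg a.coe_nonneg,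
      ENNReal.ofReal_coe_nnreal]

/-- Finiteness matters: in `EReal` the difference `⊤ - ⊤` is `⊥`, of absolute value `⊤`. -/
lemma abs_coe_sub_coe_le_iff {a b e : ℝ≥0∞} (ha : a ≠ ⊤) (hb : b ≠ ⊤) :
    ((a : EReal) - (b : EReal)).abs ≤ e ↔ a ≤ b + e ∧ b ≤ a + e := by
  lift a to NNReal using ha
  lift b to NNReal using hb
  induction e with
  | top => simp
  | coe e =>
    rw [EReal.coe_nnreal_eq_coe_real, EReal.coe_nnreal_eq_coe_real, ← EReal.coe_sub,
      EReal.abs_def, ENNReal.ofReal_le_coe, abs_le]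
    norm_cast
    rw [← NNReal.coe_le_coe, ← NNReal.coe_le_coe, NNReal.coe_add, NNReal.coe_add]
    constructor
    · rintro ⟨h1, h2⟩; constructor <;> linarith
    · rintro ⟨h1, h2⟩; constructor <;> linarith

lemma coe_sub_coe_le_coe_real {a b : ℝ≥0∞} {r : ℝ} (hr : 0 ≤ r) (hb : b ≠ ⊤)
    (h : a ≤ b + ENNReal.ofReal r) : (a : EReal) - (b : EReal) ≤ (r : EReal) := by
  lift b to NNReal using hb
  have ha : a ≠ ⊤ := (h.trans_lt (by simp)).ne
  lift a to NNReal using ha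
  rw [EReal.coe_nnreal_eq_coe_real, EReal.coe_nnreal_eq_coe_real, ← EReal.coe_sub,
    EReal.coe_le_coe_iff]
  rw [← ENNReal.ofReal_coe_nnreal, ← ENNReal.ofReal_coe_nnreal (p := b),
    ← ENNReal.ofReal_add b.coe_nonneg hr,
    ENNReal.ofReal_le_ofReal_iff (add_nonneg b.coe_nonneg hr)] at h
  linarith

variable {S : Type*} {w : S → ℝ}

lemma wnorm_le_iff (hw : ∀ x, 1 ≤ w x) {u : S → EReal} {d : ℝ≥0∞} :
    wnorm w u ≤ d ↔ ∀ x, (u x).abs ≤ d * ENNReal.ofReal (w x) := by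
  rw [wnorm, iSup_le_iff]
  refine forall_congr' fun x => ENNReal.div_le_iff ?_ ENNReal.ofReal_ne_top
  exact (ENNReal.ofReal_pos.2 (zero_lt_one.trans_le (hw x))).ne'

lemma wnorm_coe_le_iff (hw : ∀ x, 1 ≤ w x) {u : S → ℝ≥0∞} {d : ℝ≥0∞} :
    wnorm w (fun x => (u x : EReal)) ≤ d ↔ ∀ x, u x ≤ d * ENNReal.ofReal (w x) := by
  simp_rw [wnorm_le_iff hw, abs_coe_ennreal]

lemma wnorm_coe_sub_le_iff (hw : ∀ x, 1 ≤ w x) {u u' : S → ℝ≥0∞} (hu : ∀ x, u x ≠ ⊤)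
    (hu' : ∀ x, u' x ≠ ⊤) {d : ℝ≥0∞} :
    wnorm w (fun x => (u x : EReal) - (u' x : EReal)) ≤ d ↔
      (∀ x, u x ≤ u' x + d * ENNReal.ofReal (w x)) ∧
        ∀ x, u' x ≤ u x + d * ENNReal.ofReal (w x) := by
  rw [wnorm_le_iff hw, ← forall_and]
  exact forall_congr' fun x => abs_coe_sub_coe_le_iff (hu x) (hu' x)

lemma le_wnorm_mul (hw : ∀ x, 1 ≤ w x) (u : S → ℝ≥0∞) (x : S) :
    u x ≤ wnorm w (fun x => (u x : EReal)) * ENNReal.ofReal (w x) :=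
  (wnorm_coe_le_iff hw).1 le_rfl x

variable [MeasurableSpace S]

lemma inWeightedCone_of_le (hw : ∀ x, 1 ≤ w x) {u : S → ℝ≥0∞} (hu : Measurable u) {d : ℝ≥0∞}
    (hd : d ≠ ⊤) (h : ∀ x, u x ≤ d * ENNReal.ofReal (w x)) : InWeightedCone w u :=
  ⟨hu, ((wnorm_coe_le_iff hw).2 h).trans_lt hd.lt_top⟩

lemma InWeightedCone.ne_top (hw : ∀ x, 1 ≤ w x) {u : S → ℝ≥0∞} (h : InWeightedCone w u) (x : S) :
    u x ≠ ⊤ :=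
  ((le_wnorm_mul hw u x).trans_lt (ENNReal.mul_lt_top h.2 ENNReal.ofReal_lt_top)).ne

end WeightedNorm

lemma le_of_forall_le_add_mul_pow {a b D g : ℝ≥0∞} (hD : D ≠ ⊤) (hg : g < 1)
    (h : ∀ n : ℕ, a ≤ b + D * g ^ n) : a ≤ b := by
  have ht : Filter.Tendsto (fun n : ℕ => b + D * g ^ n) Filter.atTop (nhds (b + D * 0)) :=
    tendsto_const_nhds.add (ENNReal.Tendsto.const_mul
      (ENNReal.tendsto_pow_atTop_nhds_zero_of_lt_one hg) (Or.inr hD))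
  rw [mul_zero, add_zero] at ht
  exact ge_of_tendsto' ht h

/-! ### Contraction, convergence of the value iterations, and comparison of fixed points. -/

namespace MarkovControlModel

/-- Weighted growth conditions: the cost is at most `C w`, and the discounted transition operator
maps `w` to a function that is at most `g w`. -/
structure WeightedGrowth {X A : Type*} [MeasurableSpace X] [MeasurableSpace A]
    (M : MarkovControlModel X A) (K : Set X) (α : ℝ) (w : (Kᶜ : Set X) → ℝ) (C g : ℝ≥0∞) :
    Prop where
  measurable_weight : Measurable w
  one_le_weight : ∀ x, 1 ≤ w x
  cost_le : ∀ (x : (Kᶜ : Set X)) (a : A) (ha : a ∈ M.feasible x),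
    ENNReal.ofReal (M.c ⟨((x : X), a), ha⟩) ≤ C * ENNReal.ofReal (w x)
  transition_le : ∀ (x : (Kᶜ : Set X)) (a : A) (ha : a ∈ M.feasible x),
    ENNReal.ofReal α * ∫⁻ y, ENNReal.ofReal (w y) ∂((M.Q ⟨((x : X), a), ha⟩).comap
      (Subtype.val : (Kᶜ : Set X) → X)) ≤ g * ENNReal.ofReal (w x)

variable {X A : Type*} [MeasurableSpace X] [MeasurableSpace A] {M : MarkovControlModel X A}
  {K : Set X} {α : ℝ} {w : (Kᶜ : Set X) → ℝ} {C g : ℝ≥0∞}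

lemma valueIter_le_succ (n : ℕ) : M.valueIter K α n ≤ M.valueIter K α (n + 1) := by
  induction n with
  | zero => exact fun _ => zero_le
  | succ n ih => exact M.T_mono ih

lemma SolvesDCOE.T_eq {u : (Kᶜ : Set X) → ℝ≥0∞} (h : M.SolvesDCOE K α u) :
    M.T K α u = u :=
  funext fun x => (h x).csInf_eq

namespace WeightedGrowth

/-- One-sided contraction: the perturbation `d w` passes through the integral and the discounted
kernel multiplies it by at most `g`, uniformly in the action. Subtraction in `ℝ≥0∞` is avoided. -/
lemma T_le_T_add (h : M.WeightedGrowth K α w C g) {u u' : (Kᶜ : Set X) → ℝ≥0∞} {d : ℝ≥0∞}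
    (hle : ∀ x, u x ≤ u' x + d * ENNReal.ofReal (w x)) (x : (Kᶜ : Set X)) :
    M.T K α u x ≤ M.T K α u' x + g * d * ENNReal.ofReal (w x) := by
  have hw : Measurable fun y => d * ENNReal.ofReal (w y) :=
    h.measurable_weight.ennreal_ofReal.const_mul _
  unfold T
  rw [ENNReal.iInf_add]
  refine iInf_mono fun a => ?_
  set ν := (M.Q ⟨((x : X), (a : A)), a.2⟩).comap (Subtype.val : (Kᶜ : Set X) → X)
  have htr := h.transition_le x a a.2
  calc M.stageCost K α u ⟨((x : X), (a : A)), a.2⟩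
      ≤ ENNReal.ofReal (M.c ⟨((x : X), (a : A)), a.2⟩) +
        ENNReal.ofReal α * ∫⁻ y, (u' y + d * ENNReal.ofReal (w y)) ∂ν := by
        unfold stageCost
        exact add_le_add le_rfl (mul_le_mul' le_rfl (lintegral_mono hle))
    _ = M.stageCost K α u' ⟨((x : X), (a : A)), a.2⟩ +
        d * (ENNReal.ofReal α * ∫⁻ y, ENNReal.ofReal (w y) ∂ν) := by
        rw [lintegral_add_right _ hw, lintegral_const_mul _ h.measurable_weight.ennreal_ofReal,
          mul_add, ← add_assoc, mul_left_comm]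
        rfl
    _ ≤ _ := by
        refine add_le_add le_rfl ((mul_le_mul' le_rfl htr).trans_eq ?_)
        rw [← mul_assoc, mul_comm d g]

lemma T_zero_le (h : M.WeightedGrowth K α w C g) (x : (Kᶜ : Set X)) :
    M.T K α (fun _ => 0) x ≤ C * ENNReal.ofReal (w x) := by
  obtain ⟨a, ha⟩ := M.feasible_nonempty x
  refine (M.T_le_stageCost _ x ha).trans ?_
  refine le_of_eq_of_le ?_ (h.cost_le x a ha)
  simp only [stageCost, lintegral_zero, mul_zero, add_zero]
  rfl

lemma valueIter_succ_le (h : M.WeightedGrowth K α w C g) (n : ℕ) (x : (Kᶜ : Set X)) :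
    M.valueIter K α (n + 1) x ≤
      M.valueIter K α n x + C * g ^ n * ENNReal.ofReal (w x) := by
  induction n generalizing x with
  | zero => simpa [valueIter] using h.T_zero_le x
  | succ n ih =>
    refine (h.T_le_T_add ih x).trans_eq ?_
    rw [pow_succ', mul_left_comm]
    rfl

lemma valueIter_add_le (h : M.WeightedGrowth K α w C g) (n k : ℕ) (x : (Kᶜ : Set X)) :
    M.valueIter K α (n + k) x ≤
      M.valueIter K α n x + C * (g ^ n * (1 - g)⁻¹) * ENNReal.ofReal (w x) := by
  have key : M.valueIter K α (n + k) x ≤ M.valueIter K α n x +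
      C * (g ^ n * ∑ i ∈ Finset.range k, g ^ i) * ENNReal.ofReal (w x) := by
    induction k with
    | zero => simp
    | succ k ih =>
      refine (h.valueIter_succ_le (n + k) x).trans ?_
      refine (add_le_add_left ih _).trans_eq ?_
      rw [Finset.sum_range_succ, pow_add]
      ring
  refine key.trans ?_
  gcongr
  rw [← ENNReal.tsum_geometric]
  exact ENNReal.sum_le_tsum _

lemma iSup_valueIter_le (h : M.WeightedGrowth K α w C g) (n : ℕ) (x : (Kᶜ : Set X)) :
    ⨆ m, M.valueIter K α m x ≤
      M.valueIter K α n x + C * (g ^ n * (1 - g)⁻¹) * ENNReal.ofReal (w x) := by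
  refine iSup_le fun m => ?_
  rcases le_total n m with hnm | hmn
  · obtain ⟨k, rfl⟩ := Nat.exists_eq_add_of_le hnm
    exact h.valueIter_add_le n k x
  · exact (monotone_nat_of_le_succ (f := M.valueIter K α) valueIter_le_succ hmn x).trans
      le_self_add

lemma inv_one_sub_ne_top (hg : g < 1) : (1 - g)⁻¹ ≠ ⊤ :=
  ENNReal.inv_ne_top.2 (tsub_pos_of_lt hg).ne'

/-- The uniform weighted error bound, rather than compactness of the action sets, justifies
exchanging the infimum over actions with the limit. -/
lemma T_iSup_valueIter (h : M.WeightedGrowth K α w C g) (hC : C ≠ ⊤) (hg : g < 1) :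
    M.T K α (fun x => ⨆ n, M.valueIter K α n x) = fun x => ⨆ n, M.valueIter K α n x := by
  funext x
  apply le_antisymm
  -- Applying `T` to the bound of the supremum by `v_n` gives `v_{n+1}` plus an error; this constant
  -- is the error without its factor `g ^ n`.
  · have hD : C * (1 - g)⁻¹ * ENNReal.ofReal (w x) * g ≠ ⊤ :=
      ENNReal.mul_ne_top (ENNReal.mul_ne_top (ENNReal.mul_ne_top hC (inv_one_sub_ne_top hg))
        ENNReal.ofReal_ne_top) (hg.trans ENNReal.one_lt_top).ne
    refine le_of_forall_le_add_mul_pow hD hg fun n => ?_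
    refine (h.T_le_T_add (h.iSup_valueIter_le n) x).trans ?_
    refine add_le_add (le_iSup (fun n => M.valueIter K α n x) (n + 1)) (le_of_eq ?_)
    ring
  · refine iSup_le fun n => (valueIter_le_succ n x).trans ?_
    exact M.T_mono (fun y => le_iSup (fun n => M.valueIter K α n y) n) x

/-- Iterating the contraction multiplies the initial gap `D w` by `g ^ n`. Only the smaller function
needs a weighted bound. -/
lemma le_of_T_eq (h : M.WeightedGrowth K α w C g) (hg : g < 1) {u u' : (Kᶜ : Set X) → ℝ≥0∞}
    (hu : M.T K α u = u) (hu' : M.T K α u' = u') {D : ℝ≥0∞} (hD : D ≠ ⊤)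
    (hle : ∀ x, u x ≤ D * ENNReal.ofReal (w x)) : u ≤ u' := by
  have key : ∀ (n : ℕ) x, u x ≤ u' x + g ^ n * D * ENNReal.ofReal (w x) := by
    intro n
    induction n with
    | zero => intro x; simpa using (hle x).trans le_add_self
    | succ n ih =>
      intro x
      have := h.T_le_T_add ih x
      rwa [hu, hu', ← mul_assoc, ← pow_succ'] at this
  intro x
  refine le_of_forall_le_add_mul_pow (D := D * ENNReal.ofReal (w x))
    (ENNReal.mul_ne_top hD ENNReal.ofReal_ne_top) hg fun n => (key n x).trans_eq ?_
  ring

variable [TopologicalSpace X] [TopologicalSpace A] [StandardBorelSpace X]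
  [TopologicalSpace.MetrizableSpace A] [SecondCountableTopology A]
  [BorelSpace A] [StandardBorelSpace A]

/-- The value function is the limit of the value iterations. -/
theorem value_eq_iSup_valueIter (h : M.WeightedGrowth K α w C g) (hM : M.IsRegularOff K)
    (hsel : M.HasMeasurableSelector) (hα : 0 ≤ α) (hC : C ≠ ⊤) (hg : g < 1) :
    M.value K α = fun x => ⨆ n, M.valueIter K α n x := by
  have hK := hM.measurableSet_target
  funext x
  apply le_antisymm
  · have hm : Measurable fun x => ⨆ n, M.valueIter K α n x :=
      Measurable.iSup fun n => hM.measurable_valueIter α n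
    obtain ⟨f, hf, hmem, hmin⟩ := hM.exists_measurable_minimizer hsel α hm
    refine (iInf_le _ (Policy.stationary hf hmem)).trans
      (Policy.cost_stationary_le hK hα hm hf hmem (fun y => ?_) x)
    rw [hmin, h.T_iSup_valueIter hC hg]
  · exact iSup_le fun n => le_iInf fun π =>
      π.valueIter_le_cost hK hα (hM.measurable_valueIter α) n x

end WeightedGrowth

end MarkovControlModel

end ExitControl

end

open ExitControl in
/-- Bounds for the value function and the value iterations, and unique solvability of the
discounted cost optimality equation, under weighted growth conditions. -/
theorem proposition4p3
    -- the state and action sets are nonempty Borel subsets of Polish spaces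
    {E F : Type*}
    [TopologicalSpace E] [PolishSpace E] [MeasurableSpace E] [BorelSpace E]
    [TopologicalSpace F] [PolishSpace F] [MeasurableSpace F] [BorelSpace F]
    (X : Set E) (hX : MeasurableSet X) (hXne : X.Nonempty)
    (A : Set F) (hA : MeasurableSet A) (hAne : A.Nonempty)
    (M : MarkovControlModel X A) (K : Set X) (hK : MeasurableSet K)
    -- standing assumptions on the model
    (hsel : M.HasMeasurableSelector)
    (hcompact : ∀ x, x ∉ K → IsCompact (M.feasible x))
    (hlsc : LowerSemicontinuousOn M.c (M.pairsOff K))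
    (hnonneg : ∀ p ∈ M.pairsOff K, 0 ≤ M.c p)
    (hinf : M.CostInfCompact K)
    (hfeller : M.StronglyFeller K)
    -- discount factor and growth conditions
    (α : ℝ) (hα0 : 0 < α) (hα1 : α < 1)
    (cbar : ℝ) (hcbar : 0 < cbar)
    (β : ℝ) (hβ1 : 1 ≤ β) (hβα : β < 1 / α)
    (w : (Kᶜ : Set X) → ℝ) (hw : Measurable w) (hw1 : ∀ x, 1 ≤ w x)
    (hgrowth_c : ∀ (x : (Kᶜ : Set X)) (a : A) (ha : a ∈ M.feasible x),
      M.c ⟨((x : X), a), ha⟩ ≤ cbar * w x)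
    (hgrowth_Q : ∀ (x : (Kᶜ : Set X)) (a : A) (ha : a ∈ M.feasible x),
      ∫⁻ y, ENNReal.ofReal (w y) ∂((M.Q ⟨((x : X), a), ha⟩).comap
          (Subtype.val : (Kᶜ : Set X) → X))
        ≤ ENNReal.ofReal (β * w x))
    (γ : ℝ) (hγ : γ = α * β) :
    -- (i)
    wnorm w (fun x => (M.value K α x : EReal)) ≤ ENNReal.ofReal (cbar / (1 - γ)) ∧
    -- (ii); the value iterations are measurable and given by attained minima
    (∀ n, Measurable (M.valueIter K α n)) ∧
    (∀ n x, M.IsMinStage K α (M.valueIter K α n) x (M.valueIter K α (n + 1) x)) ∧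
    (∀ n x, (M.value K α x : EReal) - (M.valueIter K α n x : EReal)
      ≤ ((cbar * w x * (γ ^ n / (1 - γ)) : ℝ) : EReal)) ∧
    (∀ n, wnorm w (fun x => (M.valueIter K α n x : EReal) - (M.value K α x : EReal))
      ≤ ENNReal.ofReal (cbar * γ ^ n / (1 - γ))) ∧
    -- (iii)
    (InWeightedCone w (M.value K α) ∧ M.SolvesDCOE K α (M.value K α) ∧
      ∀ u, InWeightedCone w u → M.SolvesDCOE K α u → u = M.value K α) ∧
    -- the dynamic programming operator is a `γ`-contraction of the weighted cone
    (0 ≤ γ ∧ γ < 1 ∧ (∀ u, InWeightedCone w u → InWeightedCone w (M.T K α u)) ∧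
      ∀ u u', InWeightedCone w u → InWeightedCone w u' →
        wnorm w (fun x => (M.T K α u x : EReal) - (M.T K α u' x : EReal))
          ≤ ENNReal.ofReal γ * wnorm w (fun x => (u x : EReal) - (u' x : EReal))) := by
  have hγ0 : 0 < γ := hγ ▸ mul_pos hα0 (zero_lt_one.trans_le hβ1)
  have hγ1 : γ < 1 := by
    rw [hγ, mul_comm]
    exact (lt_div_iff₀ hα0).1 hβα
  have hg : ENNReal.ofReal γ < 1 := ENNReal.ofReal_lt_one.2 hγ1
  have hC : ENNReal.ofReal cbar ≠ ⊤ := ENNReal.ofReal_ne_top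
  have := hX.standardBorel
  have := hA.standardBorel
  have hM : M.IsRegularOff K := ⟨hK, hcompact, hlsc, hfeller⟩
  have hG : M.WeightedGrowth K α w (ENNReal.ofReal cbar) (ENNReal.ofReal γ) := by
    refine ⟨hw, hw1, fun x a ha => ?_, fun x a ha => ?_⟩
    · rw [← ENNReal.ofReal_mul hcbar.le]
      exact ENNReal.ofReal_le_ofReal (hgrowth_c x a ha)
    · refine (mul_le_mul' le_rfl (hgrowth_Q x a ha)).trans_eq ?_
      rw [← ENNReal.ofReal_mul hα0.le, ← ENNReal.ofReal_mul hγ0.le, hγ, mul_assoc]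
  have hval := hG.value_eq_iSup_valueIter hM hsel hα0.le hC hg
  have hmeas := hM.measurable_valueIter α
  have hvm : Measurable (M.value K α) := by
    rw [hval]
    exact Measurable.iSup hmeas
  have hTV : M.T K α (M.value K α) = M.value K α := by
    rw [hval]
    exact hG.T_iSup_valueIter hC hg
  have hgeom : ∀ n, ENNReal.ofReal cbar * (ENNReal.ofReal γ ^ n * (1 - ENNReal.ofReal γ)⁻¹) =
      ENNReal.ofReal (cbar * γ ^ n / (1 - γ)) := by
    intro n
    rw [div_eq_mul_inv, mul_assoc, ENNReal.ofReal_mul hcbar.le,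
      ENNReal.ofReal_mul (pow_nonneg hγ0.le n), ENNReal.ofReal_pow hγ0.le,
      ENNReal.ofReal_inv_of_pos (sub_pos.2 hγ1), ENNReal.ofReal_sub _ hγ0.le, ENNReal.ofReal_one]
  have herr : ∀ n x, M.value K α x ≤ M.valueIter K α n x +
      ENNReal.ofReal (cbar * γ ^ n / (1 - γ)) * ENNReal.ofReal (w x) := by
    intro n x
    rw [hval, ← hgeom]
    exact hG.iSup_valueIter_le n x
  have hle : ∀ n x, M.valueIter K α n x ≤ M.value K α x := by
    intro n x
    rw [hval]
    exact le_iSup (fun n => M.valueIter K α n x) n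
  have hVbound : ∀ x, M.value K α x ≤
      ENNReal.ofReal (cbar / (1 - γ)) * ENNReal.ofReal (w x) := by
    intro x
    simpa [MarkovControlModel.valueIter] using herr 0 x
  have hVcone : InWeightedCone w (M.value K α) :=
    inWeightedCone_of_le hw1 hvm ENNReal.ofReal_ne_top hVbound
  have hVtop : ∀ x, M.value K α x ≠ ⊤ := hVcone.ne_top hw1
  have hvtop : ∀ n x, M.valueIter K α n x ≠ ⊤ := fun n x =>
    ((hle n x).trans_lt (hVtop x).lt_top).ne
  have hTcone : ∀ u, InWeightedCone w u → InWeightedCone w (M.T K α u) := by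
    intro u hu
    -- Comparing with the zero function gives `T u ≤ T 0 + γ ‖u‖ w`, and `T 0 ≤ cbar w`.
    have hd : ENNReal.ofReal cbar +
        ENNReal.ofReal γ * wnorm w (fun x => (u x : EReal)) ≠ ⊤ :=
      ENNReal.add_ne_top.2 ⟨hC, ENNReal.mul_ne_top ENNReal.ofReal_ne_top hu.2.ne⟩
    refine inWeightedCone_of_le hw1 (hM.measurable_T α hu.1) hd fun x => ?_
    have h1 := hG.T_le_T_add (u := u) (u' := fun _ => 0)
      (fun x => (le_wnorm_mul hw1 u x).trans le_add_self) x
    rw [add_mul]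
    exact h1.trans (add_le_add_left (hG.T_zero_le x) _)
  refine ⟨(wnorm_coe_le_iff hw1).2 hVbound, hmeas, fun n x => hM.isMinStage_T α (hmeas n) x,
    fun n x => ?_, fun n => ?_, ⟨hVcone, fun x => ?_, fun u hu hsol => ?_⟩, hγ0.le, hγ1, hTcone,
    fun u u' hu hu' => ?_⟩
  · have hnn : 0 ≤ cbar * γ ^ n / (1 - γ) :=
      div_nonneg (mul_nonneg hcbar.le (pow_nonneg hγ0.le n)) (sub_pos.2 hγ1).le
    have heq : cbar * w x * (γ ^ n / (1 - γ)) = cbar * γ ^ n / (1 - γ) * w x := by ring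
    rw [heq]
    refine coe_sub_coe_le_coe_real (mul_nonneg hnn (zero_le_one.trans (hw1 x))) (hvtop n x) ?_
    rw [ENNReal.ofReal_mul hnn]
    exact herr n x
  · exact (wnorm_coe_sub_le_iff hw1 (hvtop n) hVtop).2
      ⟨fun x => (hle n x).trans le_self_add, herr n⟩
  · have := hM.isMinStage_T α hvm x
    rwa [hTV] at this
  · exact le_antisymm
      (hG.le_of_T_eq hg hsol.T_eq hTV hu.2.ne (le_wnorm_mul hw1 u))
      (hG.le_of_T_eq hg hTV hsol.T_eq ENNReal.ofReal_ne_top hVbound)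
  -- The norm of `u - u'` itself serves as `d` in both one-sided contraction estimates.
  · obtain ⟨h1, h2⟩ := (wnorm_coe_sub_le_iff hw1 (hu.ne_top hw1) (hu'.ne_top hw1)).1 le_rfl
    exact (wnorm_coe_sub_le_iff hw1 ((hTcone u hu).ne_top hw1) ((hTcone u' hu').ne_top hw1)).2
      ⟨hG.T_le_T_add h1, hG.T_le_T_add h2⟩
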